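/- Let $Y\subset X$ be open subsets of $\mathbb C$ with $Y$ bounded, let $0<t\le 2$, let $m_t$ be a Borel probability measure on $\mathbb C$ with $m_t(Y)=1$, and let $T:Y\to X$ be a continuous map. Assume that $T$ is a complex Markov map, that is: 1. there is a countable family $\mathcal Z$ of pairwise disjoint open topological discs with $\bigcup_{Z\in\mathcal Z}Z=Y$; 2. for every $Z\in\mathcal Z$ the restriction $T:Z\to X$ is a holomorphic bijection onto $X$, and $\sup_{Z\in\mathcal Z}\sup_{Z}|T''|/|T'|^2<\infty$; 3. $m_t$ is $|T'|^t$-conformal: $m_t(T(A))=\int_A|T'|^t\,dm_t$ for every Borel set $A\subset Y$ on which $T$ is injective; 4. $\inf_{y\in Y}|T'(y)|>1$; 5. the cells of the joins $\mathcal Z_0=\{X\}$ and $\mathcal Z_k=\mathcal Z\vee T^{-1}\mathcal Z\vee\dots\vee T^{-(k-1)}\mathcal Z$ ($k\ge 1$) are uniformly convex-like: $$\sup_{k\ge0}\ \sup_{Z\in\mathcal Z_k}\ \sup_{x\ne y\in Z}\frac{p_Z(x,y)}{|x-y|}<\infty,$$ where $p_Z(x,y)$ is the infimum of the lengths of the paths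 in $Z$ from $x$ to $y$. Then there is a $T$-invariant ergodic Borel probability measure $\mu$ equivalent to $m_t$ (mutually absolutely continuous). Moreover $(X,T,\mu)$ is mixing, with exponential decay of correlations: there are $C>0$ and $\rho\in(0,1)$ such that for all $f:X\to\mathbb C$ with $\|f\|_{Lips}<\infty$, all $g\in L^1(\mu)$ and all $n\ge0$, $$\left|\int f\cdot g\circ T^n\,d\mu-\int f\,d\mu\int g\,d\mu\right|\le C\,\|f\|_{Lips}\,\|g\|_{L^1(\mu)}\,\rho^n,$$ where $\|f\|_{Lips}=\sup_X|f|+\sup_{x\ne y\in X}\frac{|f(x)-f(y)|}{|x-y|}$. -/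

import Mathlib

open MeasureTheory Set Filter Topology
open scoped ENNReal NNReal

noncomputable section

/-- Infimum of the lengths of the continuous paths from `x` to `y` inside `Z`
(`⊤` if there is no path of finite length). The length is the total variation. -/
def innerDist (Z : Set ℂ) (x y : ℂ) : ℝ≥0∞ :=
  ⨅ (γ : Path x y) (_ : ∀ s, γ s ∈ Z), eVariationOn (fun s : unitInterval => γ s) Set.univ

/-- The cells of the join `𝒵 ∨ T⁻¹𝒵 ∨ ⋯ ∨ T^{-(k-1)}𝒵`; the empty join (`k = 0`) is `{X}`.
The members of `𝒵` are subsets of the domain of `T`, so only genuine iterates of `T` matter. -/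
def cylinders (T : ℂ → ℂ) (X : Set ℂ) (𝒵 : Set (Set ℂ)) (k : ℕ) : Set (Set ℂ) :=
  {A | ∃ w : Fin k → Set ℂ, (∀ i, w i ∈ 𝒵) ∧ A = {x ∈ X | ∀ i : Fin k, T^[(i : ℕ)] x ∈ w i}}

/-- `m` is `|T'|^t`-conformal for `T`, a map with domain `Y`. -/
def IsConformalMeasure (T : ℂ → ℂ) (Y : Set ℂ) (t : ℝ) (m : Measure ℂ) : Prop :=
  ∀ A : Set ℂ, MeasurableSet A → A ⊆ Y → InjOn T A →
    m (T '' A) = ∫⁻ x in A, ‖deriv T x‖ₑ ^ t ∂m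

/-- `T : Y → X` is a complex Markov map with partition `𝒵` and conformal measure `m`
of exponent `t`. The values of `T` outside `Y` play no role. -/
structure IsComplexMarkovMap (T : ℂ → ℂ) (X Y : Set ℂ) (𝒵 : Set (Set ℂ)) (t : ℝ)
    (m : Measure ℂ) : Prop where
  isOpen_X : IsOpen X
  isOpen_Y : IsOpen Y
  subset : Y ⊆ X
  mapsTo : MapsTo T Y X
  continuousOn : ContinuousOn T Y
  t_pos : 0 < t
  t_le_two : t ≤ 2
  isProbabilityMeasure : IsProbabilityMeasure m
  measure_Y : m Y = 1
  countable : 𝒵.Countable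
  pairwiseDisjoint : 𝒵.PairwiseDisjoint id
  isOpen_cell : ∀ Z ∈ 𝒵, IsOpen Z
  /-- every cell is a topological disc -/
  disc_cell : ∀ Z ∈ 𝒵, Nonempty (Z ≃ₜ Metric.ball (0 : ℂ) 1)
  sUnion_cell : ⋃₀ 𝒵 = Y
  /-- every branch is a conformal diffeomorphism onto `X` -/
  holomorphic : ∀ Z ∈ 𝒵, DifferentiableOn ℂ T Z
  bijOn : ∀ Z ∈ 𝒵, BijOn T Z X
  distortion : ∃ K : ℝ, ∀ Z ∈ 𝒵, ∀ z ∈ Z, ‖deriv (deriv T) z‖ / ‖deriv T z‖ ^ 2 ≤ K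
  conformal : IsConformalMeasure T Y t m
  expanding : ∃ κ : ℝ, 1 < κ ∧ ∀ y ∈ Y, κ ≤ ‖deriv T y‖
  /-- the cylinders are uniformly convex-like -/
  convexLike : ∃ K : ℝ≥0, ∀ k : ℕ, ∀ Z ∈ cylinders T X 𝒵 k, ∀ x ∈ Z, ∀ y ∈ Z, x ≠ y →
    innerDist Z x y / ‖x - y‖ₑ ≤ K

/-- The partially defined map `T : Y → X` as a total map, with a constant value outside `Y`.
It is used with measures for which the complement of `Y` is a null set. -/
def totalMap (T : ℂ → ℂ) (Y : Set ℂ) : ℂ → ℂ := Y.indicator T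

/-- The norm `sup |f| + sup_{x ≠ y} |f x - f y| / |x - y|` of a function on `X`. -/
def lipNorm (X : Set ℂ) (f : ℂ → ℂ) : ℝ≥0∞ :=
  (⨆ x ∈ X, ‖f x‖ₑ) + ⨆ x ∈ X, ⨆ y ∈ X, ⨆ _ : x ≠ y, ‖f x - f y‖ₑ / ‖x - y‖ₑ

/-- `(F, μ)` is mixing. -/
def IsMixing (F : ℂ → ℂ) (μ : Measure ℂ) : Prop :=
  ∀ A B : Set ℂ, MeasurableSet A → MeasurableSet B →
    Tendsto (fun n : ℕ => μ (A ∩ F^[n] ⁻¹' B)) atTop (𝓝 (μ A * μ B))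

end

/-! Write S_Z for the inverse branches of T. Conformality says that the operator Lφ = Σ_Z
|T'∘S_Z|^(-t) φ∘S_Z satisfies ∫ Lw · g dm = ∫ w · g∘T dm. A positive fixed point φ of L is therefore
the density of an invariant measure, and decay of correlations is convergence of L^n(fφ) to (∫ fφ
dm) φ.

Let d be a metric on X contracted by all S_Z, in which the logarithms of the weights are uniformly
Lipschitz with constant B. If log φ is A-Lipschitz, then log Lφ is (B + rA)-Lipschitz with r < 1
(`logLip_transferOp`). For large A this is a strict improvement, and since d is bounded there is
room to split off a fixed multiple ε of the constant 1 from every normalized image (`exists_split`).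
Two normalized densities thus share mass ε after each step, and their difference decays like (1 -
ε)^n (`exists_contraction`).

The metric is `lipDist`, the largest difference of a locally 1-Lipschitz function at two points.
Pointwise derivative bounds become global estimates for it with the same constant, and uniform
convexity makes it comparable to |x - y|. Mixing follows by Lipschitz approximation in L¹, and
ergodicity from mixing. -/

/-! ### A metric on X dual to locally Lipschitz functions. -/

/-- `f` is locally `c`-Lipschitz at the points of `X`. -/
def LocLip (X : Set ℂ) (c : ℝ) (f : ℂ → ℝ) : Prop :=
  ∀ x ∈ X, ∃ U ∈ 𝓝 x, ∀ y ∈ U, ∀ z ∈ U, |f y - f z| ≤ c * ‖y - z‖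

/-- Compactness of the unit interval cuts a path into finitely many pieces, each inside a
neighbourhood where f is 1-Lipschitz. The chords of this subdivision add up to at most the variation
of the path. -/
theorem LocLip.edist_le_innerDist {X : Set ℂ} {f : ℂ → ℝ} (hf : LocLip X 1 f)
    (x y : ℂ) : edist (f x) (f y) ≤ innerDist X x y := by
  refine le_iInf fun γ => le_iInf fun hγ => ?_
  choose! U hU h using hf
  obtain ⟨t, h0, ht, ⟨n, hn⟩, hc⟩ := exists_monotone_Icc_subset_open_cover_unitInterval
    (c := fun s : unitInterval => γ ⁻¹' interior (U (γ s)))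
    (fun s => isOpen_interior.preimage γ.continuous)
    (fun s _ => mem_iUnion.2 ⟨s, mem_interior_iff_mem_nhds.2 (hU _ (hγ s))⟩)
  have h1 : edist (f (γ (t 0))) (f (γ (t n))) ≤
      ∑ i ∈ Finset.range n, edist (f (γ (t i))) (f (γ (t (i + 1)))) :=
    edist_le_range_sum_edist (fun i => f (γ (t i))) n
  rw [h0, hn n le_rfl, γ.source, γ.target] at h1
  refine h1.trans (le_trans (Finset.sum_le_sum fun i _ => ?_)
    (eVariationOn.sum_le (f := fun s => γ s) (n := n) ht fun _ => mem_univ _))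
  obtain ⟨s, hs⟩ := hc i
  have ha := interior_subset (hs (left_mem_Icc.2 (ht i.le_succ)))
  have hb := interior_subset (hs (right_mem_Icc.2 (ht i.le_succ)))
  have := h _ (hγ s) _ ha _ hb
  rw [edist_comm (γ (t (i + 1)))]
  simp only [edist_dist]
  refine ENNReal.ofReal_le_ofReal ?_
  rwa [Real.dist_eq, dist_eq_norm, ← one_mul ‖_‖]

/-- The distance on `X` that is dual to the locally `1`-Lipschitz functions. -/
noncomputable def lipDist (X : Set ℂ) (x y : ℂ) : ℝ :=
  sSup {r | ∃ f : ℂ → ℝ, LocLip X 1 f ∧ r = |f x - f y|}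

theorem LocLip.abs_sub_le {X : Set ℂ} {K : ℝ≥0}
    (hX : ∀ x ∈ X, ∀ y ∈ X, innerDist X x y ≤ K * ‖x - y‖ₑ) {f : ℂ → ℝ} (hf : LocLip X 1 f)
    {x y : ℂ} (hx : x ∈ X) (hy : y ∈ X) : |f x - f y| ≤ K * ‖x - y‖ := by
  have h1 : edist (f x) (f y) ≤ K * ‖x - y‖ₑ := by
    have := hf.edist_le_innerDist x y
    exact this.trans (hX x hx y hy)
  rw [edist_dist, Real.dist_eq] at h1
  have h2 := ENNReal.toReal_mono (by finiteness) h1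
  rw [ENNReal.toReal_ofReal (abs_nonneg _)] at h2
  simpa using h2

section

variable {X : Set ℂ} {K : ℝ≥0} (hX : ∀ x ∈ X, ∀ y ∈ X, innerDist X x y ≤ K * ‖x - y‖ₑ)

theorem lipDist_nonneg (x y : ℂ) : 0 ≤ lipDist X x y :=
  Real.sSup_nonneg fun _ ⟨_, _, hr⟩ => hr ▸ abs_nonneg _

include hX

theorem lipDist_le {x y : ℂ} (hx : x ∈ X) (hy : y ∈ X) : lipDist X x y ≤ K * ‖x - y‖ :=
  Real.sSup_le (fun _ ⟨_, hf, hr⟩ => hr ▸ hf.abs_sub_le hX hx hy) (by positivity)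

theorem LocLip.abs_sub_le_lipDist {f : ℂ → ℝ} {c : ℝ} (hc : 0 < c) (hf : LocLip X c f)
    {x y : ℂ} (hx : x ∈ X) (hy : y ∈ X) : |f x - f y| ≤ c * lipDist X x y := by
  have h1 : LocLip X 1 (fun z => f z / c) := fun z hz => by
    obtain ⟨U, hU, h⟩ := hf z hz
    refine ⟨U, hU, fun y hy z hz => ?_⟩
    rw [← sub_div, abs_div, abs_of_pos hc, div_le_iff₀ hc]
    linarith [h y hy z hz]
  have h2 : |f x / c - f y / c| ≤ lipDist X x y :=
    -- The bound K‖x - y‖ is essential here: the real `sSup` of an unbounded set is 0.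
    le_csSup ⟨K * ‖x - y‖, fun _ ⟨_, hf, hr⟩ => hr ▸ hf.abs_sub_le hX hx hy⟩ ⟨_, h1, rfl⟩
  rw [← sub_div, abs_div, abs_of_pos hc, div_le_iff₀ hc] at h2
  linarith

theorem norm_sub_le_lipDist {x y : ℂ} (hx : x ∈ X) (hy : y ∈ X) : ‖x - y‖ ≤ lipDist X x y := by
  have h : LocLip X 1 (fun z => ‖z - y‖) := fun z _ => ⟨univ, univ_mem, fun a _ b _ => by
    have := abs_norm_sub_norm_le (a - y) (b - y)
    simpa using this⟩
  simpa using h.abs_sub_le_lipDist hX one_pos hx hy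

/-- Composition with S turns locally 1-Lipschitz test functions into locally c-Lipschitz ones, so by
duality the local constant c is also the global one, even when X is not convex. -/
theorem lipDist_comp_le {S : ℂ → ℂ} {c : ℝ} (hc : 0 < c) (hS : MapsTo S X X)
    (hcont : ContinuousOn S X) (hXo : IsOpen X)
    (hlip : ∀ x ∈ X, ∃ U ∈ 𝓝 x, ∀ y ∈ U, ∀ z ∈ U, ‖S y - S z‖ ≤ c * ‖y - z‖)
    {x y : ℂ} (hx : x ∈ X) (hy : y ∈ X) : lipDist X (S x) (S y) ≤ c * lipDist X x y := by
  refine Real.sSup_le ?_ (mul_nonneg hc.le (lipDist_nonneg _ _))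
  rintro r ⟨f, hf, rfl⟩
  refine LocLip.abs_sub_le_lipDist (f := fun z => f (S z)) hX hc (fun z hz => ?_) hx hy
  obtain ⟨U, hU, h⟩ := hf (S z) (hS hz)
  obtain ⟨V, hV, h'⟩ := hlip z hz
  refine ⟨V ∩ S ⁻¹' U, inter_mem hV ((hcont.continuousAt (hXo.mem_nhds hz)) hU), ?_⟩
  rintro a ⟨ha, ha'⟩ b ⟨hb, hb'⟩
  have := h _ ha' _ hb'
  have := h' _ ha _ hb
  simp only [one_mul] at *
  linarith

end

/-! ### Transfer operators of abstract contracting systems. -/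

/-- `log φ` is `A`-Lipschitz for the distance `d`. -/
def LogLip {α : Type*} (d : α → α → ℝ) (A : ℝ) (φ : α → ℝ) : Prop :=
  (∀ x, 0 < φ x) ∧ ∀ x y, φ x ≤ Real.exp (A * d x y) * φ y

/-- A probability space that is the disjoint union of the images of the contractions `S i`,
whose Jacobians `u i` have bounded distortion. -/
structure ContractingSystem {α ι : Type*} [MeasurableSpace α] (m : Measure α)
    (d : α → α → ℝ) (S : ι → α → α) (u : ι → α → ℝ) (D r B : ℝ) : Prop where
  d_nonneg : ∀ x y, 0 ≤ d x y
  d_le : ∀ x y, d x y ≤ D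
  r_nonneg : 0 ≤ r
  r_lt_one : r < 1
  B_pos : 0 < B
  contract : ∀ i x y, d (S i x) (S i y) ≤ r * d x y
  u_pos : ∀ i x, 0 < u i x
  u_le : ∀ i x y, u i x ≤ Real.exp (B * d x y) * u i y
  measurable_S : ∀ i, Measurable (S i)
  measurable_u : ∀ i, Measurable (u i)
  measurable_of_logLip : ∀ A φ, LogLip d A φ → Measurable φ
  sum_eq : Measure.sum
    (fun i => (m.withDensity fun x => ENNReal.ofReal (u i x)).map (S i)) = m

/-- The transfer operator of a family of inverse branches `S i` with weights `u i`. -/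
noncomputable def transferOp {α ι : Type*} (S : ι → α → α) (u : ι → α → ℝ) (φ : α → ℝ)
    (x : α) : ℝ :=
  ∑' i, u i x * φ (S i x)

theorem LogLip.mono {α : Type*} {d : α → α → ℝ} (hd : ∀ x y, 0 ≤ d x y) {A A' : ℝ}
    (hA : A ≤ A') {φ : α → ℝ} (hφ : LogLip d A φ) : LogLip d A' φ :=
  ⟨hφ.1, fun x y => (hφ.2 x y).trans (mul_le_mul_of_nonneg_right (Real.exp_le_exp.2
    (mul_le_mul_of_nonneg_right hA (hd _ _))) (hφ.1 y).le)⟩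

theorem logLip_const {α : Type*} (d : α → α → ℝ) {c : ℝ} (hc : 0 < c) :
    LogLip d 0 (fun _ : α => c) :=
  ⟨fun _ => hc, fun x y => by simp⟩

section

variable {α ι : Type*} {S : ι → α → α} {u : ι → α → ℝ}

theorem transferOp_smul (c : ℝ) (φ : α → ℝ) :
    transferOp S u (c • φ) = c • transferOp S u φ := by
  ext x
  simp only [transferOp, Pi.smul_apply, smul_eq_mul, ← tsum_mul_left]
  congr 1
  ext i
  ring

theorem transferOp_iterate_smul (c : ℝ) (φ : α → ℝ) (n : ℕ) :
    (transferOp S u)^[n] (c • φ) = c • (transferOp S u)^[n] φ := by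
  induction n with
  | zero => rfl
  | succ n ih => simp only [Function.iterate_succ_apply', ih, transferOp_smul]

end

namespace ContractingSystem

variable {α ι : Type*} [MeasurableSpace α] {m : Measure α} {d : α → α → ℝ} {S : ι → α → α}
  {u : ι → α → ℝ} {D r B : ℝ}

theorem le_exp_of_logLip (h : ContractingSystem m d S u D r B) {A : ℝ} (hA : 0 ≤ A) {φ : α → ℝ}
    (hφ : LogLip d A φ) (x y : α) : φ x ≤ Real.exp (A * D) * φ y :=
  (hφ.2 x y).trans (mul_le_mul_of_nonneg_right
    (Real.exp_le_exp.2 (mul_le_mul_of_nonneg_left (h.d_le _ _) hA)) (hφ.1 y).le)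

theorem integral_branch (h : ContractingSystem m d S u D r B) {E : Type*} [NormedAddCommGroup E]
    [NormedSpace ℝ E] {k : α → E} (i : ι) (hk : AEStronglyMeasurable k
      ((m.withDensity fun x => ENNReal.ofReal (u i x)).map (S i))) :
    ∫ x, k x ∂((m.withDensity fun x => ENNReal.ofReal (u i x)).map (S i)) =
      ∫ x, u i x • k (S i x) ∂m := by
  rw [integral_map (h.measurable_S i).aemeasurable hk,
    integral_withDensity_eq_integral_toReal_smul (h.measurable_u i).ennreal_ofReal
      (ae_of_all _ fun _ => ENNReal.ofReal_lt_top)]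
  simp only [ENNReal.toReal_ofReal (h.u_pos _ _).le]

variable [Countable ι]

theorem lintegral_eq (h : ContractingSystem m d S u D r B) {k : α → ℝ≥0∞} (hk : Measurable k) :
    ∫⁻ x, k x ∂m = ∫⁻ x, ∑' i, ENNReal.ofReal (u i x) * k (S i x) ∂m := by
  conv_lhs => rw [← h.sum_eq]
  rw [lintegral_sum_measure, lintegral_tsum]
  · congr 1
    ext i
    rw [lintegral_map hk (h.measurable_S i)]
    exact lintegral_withDensity_eq_lintegral_mul _
      (h.measurable_u i).ennreal_ofReal (hk.comp (h.measurable_S i))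
  · exact fun i => ((h.measurable_u i).ennreal_ofReal.mul
      (hk.comp (h.measurable_S i))).aemeasurable

theorem integral_eq (h : ContractingSystem m d S u D r B) {E : Type*} [NormedAddCommGroup E]
    [NormedSpace ℝ E] {k : α → E} (hk : Integrable k m) :
    ∫ x, k x ∂m = ∫ x, ∑' i, u i x • k (S i x) ∂m := by
  have hae : ∀ i, AEStronglyMeasurable k
      ((m.withDensity fun x => ENNReal.ofReal (u i x)).map (S i)) := fun i =>
    hk.1.mono_measure ((Measure.le_sum _ i).trans_eq h.sum_eq)
  have hint : ∀ i, Integrable k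
      ((m.withDensity fun x => ENNReal.ofReal (u i x)).map (S i)) := fun i =>
    hk.mono_measure ((Measure.le_sum _ i).trans_eq h.sum_eq)
  have hint' : ∀ i, Integrable (fun x => u i x • k (S i x)) m := fun i => by
    have h1 := (integrable_map_measure (hae i) (h.measurable_S i).aemeasurable).1 (hint i)
    rw [integrable_withDensity_iff_integrable_smul' (h.measurable_u i).ennreal_ofReal
        (ae_of_all _ fun _ => ENNReal.ofReal_lt_top)] at h1
    simpa only [ENNReal.toReal_ofReal (h.u_pos _ _).le, Function.comp_apply] using h1
  have hs := hasSum_integral_measure (f := k) (by rwa [h.sum_eq])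
  -- The sum for ‖k‖ supplies the absolute summability needed to exchange sum and integral.
  have hs' := hasSum_integral_measure (f := fun x => ‖k x‖) (by rw [h.sum_eq]; exact hk.norm)
  rw [h.sum_eq] at hs hs'
  simp only [fun i => h.integral_branch i (hae i)] at hs
  simp only [fun i => h.integral_branch i (hae i).norm] at hs'
  refine hs.unique (hasSum_integral_of_summable_integral_norm hint' ?_)
  have hn : ∀ i x, ‖u i x • k (S i x)‖ = u i x • ‖k (S i x)‖ := fun i x => by
    rw [norm_smul, Real.norm_of_nonneg (h.u_pos _ _).le, smul_eq_mul]
  simpa only [hn] using hs'.summable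

variable [IsProbabilityMeasure m]

theorem nonempty (h : ContractingSystem m d S u D r B) : Nonempty ι := by
  by_contra hι
  rw [not_nonempty_iff] at hι
  have := h.lintegral_eq (k := 1) measurable_const
  simp at this

/-- The weights sum to a function of integral 1, which is finite at some point; bounded distortion
carries finiteness to every other point. -/
theorem summable_weight (h : ContractingSystem m d S u D r B) (x : α) :
    Summable fun i => u i x := by
  have h1 : ∫⁻ x, ∑' i, ENNReal.ofReal (u i x) ∂m ≠ ∞ := by
    have := h.lintegral_eq (k := 1) measurable_const
    simp only [Pi.one_apply, mul_one] at this
    rw [← this]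
    simp
  obtain ⟨y, hy⟩ := (ae_lt_top (Measurable.tsum
    fun i => (h.measurable_u i).ennreal_ofReal) h1).exists
  have h2 : Summable fun i => u i y := by
    have := ENNReal.summable_toReal hy.ne
    simpa only [ENNReal.toReal_ofReal (h.u_pos _ _).le] using this
  exact Summable.of_nonneg_of_le (fun i => (h.u_pos i x).le) (fun i => h.u_le i x y)
    (h2.mul_left _)

theorem summable_transfer (h : ContractingSystem m d S u D r B) {φ : α → ℝ} {M : ℝ}
    (hφ : ∀ x, |φ x| ≤ M) (x : α) : Summable fun i => u i x * φ (S i x) := by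
  refine Summable.of_norm_bounded ((h.summable_weight x).mul_right M) fun i => ?_
  rw [norm_mul, Real.norm_of_nonneg (h.u_pos _ _).le]
  exact mul_le_mul_of_nonneg_left (hφ _) (h.u_pos _ _).le

/-- The bounds ensure summability: a divergent `tsum` is 0 and need not be additive. -/
theorem transferOp_add (h : ContractingSystem m d S u D r B) {φ ψ : α → ℝ} {M N : ℝ}
    (hφ : ∀ x, |φ x| ≤ M) (hψ : ∀ x, |ψ x| ≤ N) :
    transferOp S u (φ + ψ) = transferOp S u φ + transferOp S u ψ := by
  ext x
  simp only [transferOp, Pi.add_apply, mul_add]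
  exact (h.summable_transfer hφ x).tsum_add (h.summable_transfer hψ x)

theorem exists_bound (h : ContractingSystem m d S u D r B) {A : ℝ} (hA : 0 ≤ A) {φ : α → ℝ}
    (hφ : LogLip d A φ) : ∃ M, ∀ x, |φ x| ≤ M := by
  obtain ⟨y⟩ : Nonempty α := m.nonempty_of_neZero
  exact ⟨_, fun x => (abs_of_pos (hφ.1 x)).trans_le (h.le_exp_of_logLip hA hφ x y)⟩

theorem integrable_of_logLip (h : ContractingSystem m d S u D r B) {A : ℝ} (hA : 0 ≤ A)
    {φ : α → ℝ} (hφ : LogLip d A φ) : Integrable φ m := by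
  obtain ⟨M, hM⟩ := h.exists_bound hA hφ
  exact Integrable.of_bound (h.measurable_of_logLip _ _ hφ).aestronglyMeasurable M
    (ae_of_all _ hM)

theorem le_exp (h : ContractingSystem m d S u D r B) {A : ℝ} (hA : 0 ≤ A)
    {φ : α → ℝ} (hφ : LogLip d A φ) (h1 : ∫ x, φ x ∂m = 1) (x : α) :
    φ x ≤ Real.exp (A * D) := by
  have h2 : ∫ _, φ x ∂m ≤ ∫ y, Real.exp (A * D) * φ y ∂m :=
    integral_mono (integrable_const _) ((h.integrable_of_logLip hA hφ).const_mul _)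
      fun y => h.le_exp_of_logLip hA hφ x y
  simpa [integral_const_mul, h1] using h2

theorem exp_neg_le (h : ContractingSystem m d S u D r B) {A : ℝ} (hA : 0 ≤ A)
    {φ : α → ℝ} (hφ : LogLip d A φ) (h1 : ∫ x, φ x ∂m = 1) (x : α) :
    Real.exp (-(A * D)) ≤ φ x := by
  have h2 : ∫ y, φ y ∂m ≤ ∫ _, Real.exp (A * D) * φ x ∂m :=
    integral_mono (h.integrable_of_logLip hA hφ) (integrable_const _)
      fun y => h.le_exp_of_logLip hA hφ y x
  rw [h1] at h2
  simp only [integral_const, probReal_univ, smul_eq_mul, one_mul] at h2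
  rw [Real.exp_neg, inv_le_iff_one_le_mul₀ (Real.exp_pos _)]
  linarith

/-- Composition with a contracting branch improves A to rA, the weight costs B, and the resulting
inequality is stable under sums over branches. -/
theorem logLip_transferOp (h : ContractingSystem m d S u D r B) {A : ℝ} (hA : 0 ≤ A)
    {φ : α → ℝ} (hφ : LogLip d A φ) : LogLip d (B + r * A) (transferOp S u φ) := by
  obtain ⟨M, hM⟩ := h.exists_bound hA hφ
  obtain ⟨i⟩ := h.nonempty
  refine ⟨fun x => (h.summable_transfer hM x).tsum_pos
    (fun j => (mul_pos (h.u_pos _ _) (hφ.1 _)).le) i (mul_pos (h.u_pos _ _) (hφ.1 _)),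
    fun x y => ?_⟩
  rw [transferOp, transferOp, ← tsum_mul_left]
  refine (h.summable_transfer hM x).tsum_le_tsum (fun j => ?_)
    ((h.summable_transfer hM y).mul_left _)
  calc u j x * φ (S j x)
      ≤ (Real.exp (B * d x y) * u j y) * (Real.exp (A * d (S j x) (S j y)) * φ (S j y)) :=
        mul_le_mul (h.u_le _ _ _) (hφ.2 _ _) (hφ.1 _).le
          (mul_pos (Real.exp_pos _) (h.u_pos _ _)).le
    _ ≤ (Real.exp (B * d x y) * u j y) * (Real.exp (A * (r * d x y)) * φ (S j y)) := by
        refine mul_le_mul_of_nonneg_left (mul_le_mul_of_nonneg_right (Real.exp_le_exp.2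
          (mul_le_mul_of_nonneg_left (h.contract _ _ _) hA)) (hφ.1 _).le)
          (mul_pos (Real.exp_pos _) (h.u_pos _ _)).le
    _ = Real.exp ((B + r * A) * d x y) * (u j y * φ (S j y)) := by
        rw [show (B + r * A) * d x y = B * d x y + A * (r * d x y) by ring, Real.exp_add]
        ring

theorem integral_transferOp (h : ContractingSystem m d S u D r B) {φ : α → ℝ}
    (hφ : Integrable φ m) : ∫ x, transferOp S u φ x ∂m = ∫ x, φ x ∂m := by
  rw [h.integral_eq hφ]
  rfl

/-- The transfer operator preserves boundedness. -/
theorem exists_bound_transferOp (h : ContractingSystem m d S u D r B) :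
    ∃ Q, 0 ≤ Q ∧ ∀ (φ : α → ℝ) (M : ℝ), (∀ x, |φ x| ≤ M) → ∀ x, |transferOp S u φ x| ≤ M * Q := by
  obtain ⟨x₀⟩ : Nonempty α := m.nonempty_of_neZero
  -- Q bounds the image of the constant 1, whose values are all comparable to the one at x₀.
  have h1 := h.logLip_transferOp le_rfl (logLip_const d one_pos)
  simp only [mul_zero, add_zero] at h1
  refine ⟨Real.exp (B * D) * transferOp S u (fun _ => 1) x₀,
    mul_nonneg (Real.exp_pos _).le (h1.1 _).le, fun φ M hM x => ?_⟩
  have hM0 : 0 ≤ M := (abs_nonneg _).trans (hM x)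
  refine le_trans ?_ (mul_le_mul_of_nonneg_left (h.le_exp_of_logLip h.B_pos.le h1 x x₀) hM0)
  rw [transferOp, transferOp, ← tsum_mul_left, ← Real.norm_eq_abs]
  refine tsum_of_norm_bounded (Summable.hasSum ?_) fun i => ?_
  · simpa using (h.summable_weight x).mul_left M
  · rw [norm_mul, Real.norm_of_nonneg (h.u_pos _ _).le, mul_one, mul_comm]
    exact mul_le_mul_of_nonneg_right (hM _) (h.u_pos _ _).le

theorem exists_bound_iterate (h : ContractingSystem m d S u D r B) {φ : α → ℝ} {M : ℝ}
    (hφ : ∀ x, |φ x| ≤ M) (n : ℕ) : ∃ N, ∀ x, |(transferOp S u)^[n] φ x| ≤ N := by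
  obtain ⟨Q, -, hQ⟩ := h.exists_bound_transferOp
  induction n with
  | zero => exact ⟨M, hφ⟩
  | succ n ih =>
    obtain ⟨N, hN⟩ := ih
    exact ⟨_, by simpa only [Function.iterate_succ_apply'] using hQ _ N hN⟩

theorem iterate_add (h : ContractingSystem m d S u D r B) {φ ψ : α → ℝ} {M N : ℝ}
    (hφ : ∀ x, |φ x| ≤ M) (hψ : ∀ x, |ψ x| ≤ N) (n : ℕ) :
    (transferOp S u)^[n] (φ + ψ) = (transferOp S u)^[n] φ + (transferOp S u)^[n] ψ := by
  induction n with
  | zero => rfl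
  | succ n ih =>
    obtain ⟨M', hM'⟩ := h.exists_bound_iterate hφ n
    obtain ⟨N', hN'⟩ := h.exists_bound_iterate hψ n
    simp only [Function.iterate_succ_apply', ih, h.transferOp_add hM' hN']

/-- A function with small logarithmic Lipschitz constant is a convex combination of the constant
`1` and a function with a larger logarithmic Lipschitz constant. -/
theorem exists_split (h : ContractingSystem m d S u D r B) {A A' : ℝ} (hA' : 0 < A')
    (hA : A' < A) : ∃ ε : ℝ, 0 < ε ∧ ε < 1 ∧ ∀ φ, LogLip d A' φ → ∫ x, φ x ∂m = 1 →
      ∃ ψ, LogLip d A ψ ∧ ∫ x, ψ x ∂m = 1 ∧ φ = ε • (fun _ => 1) + (1 - ε) • ψ := by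
  obtain ⟨x₀⟩ : Nonempty α := m.nonempty_of_neZero
  -- The factors of ε come from the requirement ε A e^(AD) ≤ (A - A') e^(-A'D), used in `e3`. Also ε
  -- < e^(-A'D) ≤ φ, so φ - ε stays positive.
  have hD : 0 ≤ D := (h.d_nonneg x₀ x₀).trans (h.d_le _ _)
  have hApos := hA'.trans hA
  set ε := (A - A') / A * (Real.exp (-(A * D)) * Real.exp (-(A' * D))) with hε
  have hε0 : 0 < ε := by
    have := sub_pos.2 hA
    positivity
  have hε1 : ε < Real.exp (-(A' * D)) := by
    have h1 : (A - A') / A < 1 := by rw [div_lt_one hApos]; linarith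
    have h2 : Real.exp (-(A * D)) * Real.exp (-(A' * D)) ≤ Real.exp (-(A' * D)) :=
      mul_le_of_le_one_left (Real.exp_pos _).le
        (Real.exp_le_one_iff.2 (neg_nonpos.2 (by positivity)))
    calc ε < 1 * (Real.exp (-(A * D)) * Real.exp (-(A' * D))) :=
          mul_lt_mul_of_pos_right h1 (by positivity)
      _ ≤ _ := by rwa [one_mul]
  have hε2 : ε < 1 := hε1.trans_le (Real.exp_le_one_iff.2 (neg_nonpos.2 (by positivity)))
  have h1ε : 0 < 1 - ε := by linarith
  refine ⟨ε, hε0, hε2, fun φ hφ hi => ⟨fun x => (φ x - ε) / (1 - ε), ⟨fun x => ?_, fun x y => ?_⟩,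
    ?_, ?_⟩⟩
  · have := h.exp_neg_le hA'.le hφ hi x
    exact div_pos (by linarith) h1ε
  · rw [← mul_div_assoc]
    refine div_le_div_of_nonneg_right ?_ h1ε.le
    have hd := h.d_nonneg x y
    -- As φ x ≤ e^(A'd) φ y, it suffices that ε (e^(Ad) - 1) ≤ (e^(Ad) - e^(A'd)) φ y. Both sides
    -- are of first order in d, which `e1` and `e2` quantify.
    have e1 : Real.exp (A * d x y) - 1 ≤ A * d x y * Real.exp (A * D) := by
      have a1 := Real.add_one_le_exp (-(A * d x y))
      have a2 : Real.exp (A * d x y) * Real.exp (-(A * d x y)) = 1 := by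
        rw [← Real.exp_add]; simp
      have a3 : Real.exp (A * d x y) ≤ Real.exp (A * D) :=
        Real.exp_le_exp.2 (mul_le_mul_of_nonneg_left (h.d_le _ _) hApos.le)
      have a4 : Real.exp (A * d x y) - 1 ≤ A * d x y * Real.exp (A * d x y) := by
        nlinarith [Real.exp_pos (A * d x y)]
      exact a4.trans (mul_le_mul_of_nonneg_left a3 (by positivity))
    have e2 : (A - A') * d x y ≤ Real.exp (A * d x y) - Real.exp (A' * d x y) := by
      have a1 := Real.add_one_le_exp ((A - A') * d x y)
      have a2 : Real.exp (A * d x y) =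
          Real.exp (A' * d x y) * Real.exp ((A - A') * d x y) := by
        rw [← Real.exp_add]; ring_nf
      have a3 : 1 ≤ Real.exp (A' * d x y) := Real.one_le_exp (by positivity)
      have a4 : 0 ≤ (A - A') * d x y := mul_nonneg (by linarith) hd
      rw [a2]
      nlinarith
    have e3 : ε * (Real.exp (A * d x y) - 1) ≤ (A - A') * d x y * Real.exp (-(A' * D)) := by
      refine (mul_le_mul_of_nonneg_left e1 hε0.le).trans_eq ?_
      rw [hε, Real.exp_neg (A * D)]
      field_simp
    have e4 := mul_le_mul e2 (h.exp_neg_le hA'.le hφ hi y) (Real.exp_pos _).le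
      ((mul_nonneg (by linarith) hd).trans e2)
    have e5 := hφ.2 x y
    nlinarith
  · rw [integral_div, integral_sub (h.integrable_of_logLip hA'.le hφ) (integrable_const _), hi]
    simp [div_self h1ε.ne']
  · ext x
    simp only [Pi.add_apply, Pi.smul_apply, smul_eq_mul]
    field_simp
    ring

/-- The transfer operator contracts the normalized functions with bounded logarithmic Lipschitz
constant. -/
theorem exists_contraction (h : ContractingSystem m d S u D r B) {A : ℝ} (hA : B + r * A < A) :
    ∃ C ρ : ℝ, 0 < C ∧ 0 < ρ ∧ ρ < 1 ∧ ∀ φ ψ, LogLip d A φ → LogLip d A ψ →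
      ∫ x, φ x ∂m = 1 → ∫ x, ψ x ∂m = 1 → ∀ n x,
        |(transferOp S u)^[n] φ x - (transferOp S u)^[n] ψ x| ≤ C * ρ ^ n := by
  have hB := h.B_pos
  have hr := h.r_nonneg
  have hApos : 0 < A := by
    have := h.r_lt_one
    nlinarith
  obtain ⟨ε, hε0, hε1, hε⟩ := h.exists_split (add_pos_of_pos_of_nonneg hB
    (mul_nonneg hr hApos.le)) hA
  refine ⟨Real.exp (A * D), 1 - ε, Real.exp_pos _, by linarith, by linarith,
    fun φ ψ hφ hψ iφ iψ n => ?_⟩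
  induction n generalizing φ ψ with
  | zero =>
    intro x
    have a1 := h.le_exp hApos.le hφ iφ x
    have a2 := h.le_exp hApos.le hψ iψ x
    have a3 := hφ.1 x
    have a4 := hψ.1 x
    simp only [Function.iterate_zero, id, pow_zero, mul_one]
    rw [abs_le]
    constructor <;> linarith
  | succ n ih =>
    -- One application of the operator releases the common part ε·1, which cancels in the
    -- difference. The remainders are again normalized with constant A, so the induction hypothesis
    -- applies to them with factor 1 - ε.
    have step : ∀ φ, LogLip d A φ → ∫ x, φ x ∂m = 1 → ∃ ψ, LogLip d A ψ ∧ ∫ x, ψ x ∂m = 1 ∧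
        ∀ x, (transferOp S u)^[n + 1] φ x = ε * (transferOp S u)^[n] (fun _ => 1) x +
          (1 - ε) * (transferOp S u)^[n] ψ x := fun φ hφ iφ => by
      obtain ⟨ψ, hψ, iψ, e⟩ := hε _ (h.logLip_transferOp hApos.le hφ)
        ((h.integral_transferOp (h.integrable_of_logLip hApos.le hφ)).trans iφ)
      refine ⟨ψ, hψ, iψ, fun x => ?_⟩
      obtain ⟨M, hM⟩ := h.exists_bound hApos.le hψ
      rw [Function.iterate_succ_apply, e, h.iterate_add (M := ε) (N := (1 - ε) * M),
        transferOp_iterate_smul, transferOp_iterate_smul]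
      · rfl
      · intro x
        simp [abs_of_pos hε0]
      · intro x
        simp only [Pi.smul_apply, smul_eq_mul]
        rw [abs_mul, abs_of_pos (by linarith : 0 < 1 - ε)]
        exact mul_le_mul_of_nonneg_left (hM x) (by linarith)
    obtain ⟨φ', hφ', iφ', eφ⟩ := step φ hφ iφ
    obtain ⟨ψ', hψ', iψ', eψ⟩ := step ψ hψ iψ
    intro x
    have := ih φ' ψ' hφ' hψ' iφ' iψ' x
    rw [eφ, eψ, add_sub_add_left_eq_sub, ← mul_sub, abs_mul,
      abs_of_pos (by linarith : 0 < 1 - ε), pow_succ]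
    nlinarith

theorem logLip_iterate (h : ContractingSystem m d S u D r B) {A : ℝ} (hA : 0 ≤ A)
    (hA' : B + r * A ≤ A) {φ : α → ℝ} (hφ : LogLip d A φ) (n : ℕ) :
    LogLip d A ((transferOp S u)^[n] φ) := by
  induction n with
  | zero => exact hφ
  | succ n ih =>
    rw [Function.iterate_succ_apply']
    exact (h.logLip_transferOp hA ih).mono h.d_nonneg hA'

theorem integral_iterate (h : ContractingSystem m d S u D r B) {A : ℝ} (hA : 0 ≤ A)
    (hA' : B + r * A ≤ A) {φ : α → ℝ} (hφ : LogLip d A φ) (n : ℕ) :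
    ∫ x, (transferOp S u)^[n] φ x ∂m = ∫ x, φ x ∂m := by
  induction n with
  | zero => rfl
  | succ n ih =>
    rw [Function.iterate_succ_apply', h.integral_transferOp
      (h.integrable_of_logLip hA (h.logLip_iterate hA hA' hφ n)), ih]

/-- The transfer operator has an invariant density. -/
theorem exists_density (h : ContractingSystem m d S u D r B) {A : ℝ} (hA : B + r * A ≤ A) :
    ∃ φ, LogLip d A φ ∧ ∫ x, φ x ∂m = 1 ∧ transferOp S u φ = φ := by
  have hB := h.B_pos
  have hr := h.r_nonneg
  have hr1 := h.r_lt_one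
  have hApos : 0 < A := by nlinarith
  -- The contraction needs a strict inequality; A + 1 satisfies it because r < 1.
  obtain ⟨C, ρ, hC, hρ0, hρ1, hc⟩ := h.exists_contraction (A := A + 1) (by nlinarith)
  have hone : LogLip d A (fun _ => 1) := (logLip_const d one_pos).mono h.d_nonneg hApos.le
  set w : ℕ → α → ℝ := fun n => (transferOp S u)^[n] fun _ => 1 with hw
  have hwL : ∀ n, LogLip d A (w n) := fun n => h.logLip_iterate hApos.le hA hone n
  have hwi : ∀ n, ∫ x, w n x ∂m = 1 := fun n => by
    rw [hw, h.integral_iterate hApos.le hA hone n]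
    simp
  -- Consecutive terms are n-th iterates of the two normalized functions `w 0` and `w 1`.
  have hdist : ∀ x n, dist (w n x) (w (n + 1) x) ≤ C * ρ ^ n := fun x n => by
    rw [Real.dist_eq]
    exact hc _ _ (hone.mono h.d_nonneg (by linarith)) ((hwL 1).mono h.d_nonneg (by linarith))
      (hwi 0) (hwi 1) n x
  choose φ hφ using fun x => cauchySeq_tendsto_of_complete
    (cauchySeq_of_le_geometric ρ C hρ1 (hdist x))
  have hlim : ∀ n x, |w n x - φ x| ≤ C * ρ ^ n / (1 - ρ) := fun n x =>
    dist_le_of_le_geometric_of_tendsto ρ C hρ1 (hdist x) (hφ x) n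
  have hzero : Tendsto (fun n => C * ρ ^ n / (1 - ρ)) atTop (𝓝 0) := by
    simpa using ((tendsto_pow_atTop_nhds_zero_of_lt_one hρ0.le hρ1).const_mul C).div_const (1 - ρ)
  have hφL : LogLip d A φ := by
    refine ⟨fun x => (Real.exp_pos (-(A * D))).trans_le (ge_of_tendsto' (hφ x) fun n =>
      h.exp_neg_le hApos.le (hwL n) (hwi n) x), fun x y => ?_⟩
    exact le_of_tendsto_of_tendsto' (hφ x) ((hφ y).const_mul _) fun n => (hwL n).2 x y
  refine ⟨φ, hφL, ?_, ?_⟩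
  · have hb : ∀ n, |1 - ∫ x, φ x ∂m| ≤ C * ρ ^ n / (1 - ρ) := fun n => by
      have e : ∫ x, (w n x - φ x) ∂m = 1 - ∫ x, φ x ∂m := by
        rw [integral_sub (h.integrable_of_logLip hApos.le (hwL n))
          (h.integrable_of_logLip hApos.le hφL), hwi]
      rw [← e, ← Real.norm_eq_abs]
      refine (norm_integral_le_of_norm_le_const (ae_of_all _ (hlim n))).trans_eq (by simp)
    have := ge_of_tendsto' hzero hb
    linarith [abs_nonpos_iff.1 this]
  · obtain ⟨Q, hQ0, hQ⟩ := h.exists_bound_transferOp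
    ext x
    -- The operator is continuous for uniform convergence, and it maps `w n` to `w (n + 1)`.
    have h1 : Tendsto (fun n => w (n + 1) x) atTop (𝓝 (transferOp S u φ x)) := by
      rw [tendsto_iff_norm_sub_tendsto_zero]
      refine squeeze_zero (fun _ => norm_nonneg _) (fun n => ?_)
        (by simpa using hzero.mul_const Q)
      obtain ⟨M, hM⟩ := h.exists_bound hApos.le hφL
      obtain ⟨N, hN⟩ := h.exists_bound hApos.le (hwL n)
      have h2 := hQ (w n - φ) _ (hlim n) x
      have h3 : w n = (w n - φ) + φ := by simp
      have h4 : w (n + 1) x = transferOp S u (w n - φ) x + transferOp S u φ x := by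
        conv_lhs => rw [hw]
        simp only [Function.iterate_succ_apply']
        change transferOp S u (w n) x = _
        conv_lhs => rw [h3]
        rw [h.transferOp_add (φ := w n - φ) (hlim n) hM]
        rfl
      rw [h4, add_sub_cancel_right]
      exact h2
    exact tendsto_nhds_unique h1 ((hφ x).comp (tendsto_add_atTop_nat 1))

/-- Existence of an invariant density, and exponential convergence to it. -/
theorem exists_density_decay (h : ContractingSystem m d S u D r B) :
    ∃ φ A, 0 ≤ A ∧ LogLip d A φ ∧ ∫ x, φ x ∂m = 1 ∧ transferOp S u φ = φ ∧
      ∃ C ρ : ℝ, 0 < C ∧ 0 < ρ ∧ ρ < 1 ∧ ∀ (f : α → ℝ) (M : ℝ), Measurable f →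
        (∀ x, |f x| ≤ M) → (∀ x y, |f x - f y| ≤ M * d x y) → ∀ n x,
          |(transferOp S u)^[n] (f * φ) x - (∫ y, f y * φ y ∂m) * φ x| ≤ C * M * ρ ^ n := by
  have hB := h.B_pos
  have hr := h.r_nonneg
  have hr1 := h.r_lt_one
  obtain ⟨A, hA⟩ : ∃ A, B + r * A ≤ A :=
    ⟨B / (1 - r), le_of_eq (by have : 1 - r ≠ 0 := by linarith
                               field_simp; ring)⟩
  have hA0 : 0 < A := by nlinarith
  obtain ⟨φ, hφ, iφ, eφ⟩ := h.exists_density hA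
  obtain ⟨C, ρ, hC, hρ0, hρ1, hc⟩ := h.exists_contraction (A := A + 1) (by nlinarith)
  refine ⟨φ, A, hA0.le, hφ, iφ, eφ, 3 * C, ρ, by linarith, hρ0, hρ1, fun f M hfm hf hfl n x => ?_⟩
  have hφint := h.integrable_of_logLip hA0.le hφ
  obtain ⟨N, hN⟩ := h.exists_bound hA0.le hφ
  have hn : ∀ n, (transferOp S u)^[n] φ = φ := fun n => Function.iterate_fixed eφ n
  obtain hM | hM := ((abs_nonneg _).trans (hf x)).eq_or_lt
  · have hf0 : f = 0 := by
      ext y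
      have := hf y
      rw [← hM] at this
      exact abs_nonpos_iff.1 this
    have : (f * φ) = (0 : ℝ) • φ := by rw [hf0]; simp
    rw [this, transferOp_iterate_smul, hf0, ← hM]
    simp
  have hb : ∀ x, |(f * φ) x| ≤ M * N := fun x => by
    rw [Pi.mul_apply, abs_mul]
    exact mul_le_mul (hf x) (hN x) (abs_nonneg _) hM.le
  have hfint : Integrable (fun x => f x * φ x) m :=
    Integrable.of_bound (hfm.mul (h.measurable_of_logLip _ _ hφ)).aestronglyMeasurable _
      (ae_of_all _ hb)
  -- The shift puts f + 2M in [M, 3M], so its logarithm is 1-Lipschitz and ψ has constant A + 1.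
  -- Since φ is fixed, the added multiple of φ cancels at the end. The integral I ≤ 3M used to
  -- normalize ψ accounts for the factor 3 in the constant.
  set ψ : α → ℝ := f * φ + (2 * M) • φ with hψ
  have hψx : ∀ x, ψ x = (f x + 2 * M) * φ x := fun x => by
    simp only [hψ, Pi.add_apply, Pi.mul_apply, Pi.smul_apply, smul_eq_mul]
    ring
  have hlow : ∀ x, M ≤ f x + 2 * M := fun x => by linarith [(abs_le.1 (hf x)).1]
  have hψL : LogLip d (A + 1) ψ := by
    refine ⟨fun x => by rw [hψx]; exact mul_pos (hM.trans_le (hlow x)) (hφ.1 x), fun x y => ?_⟩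
    rw [hψx, hψx, add_mul A, Real.exp_add]
    have h1 : f x + 2 * M ≤ Real.exp (1 * d x y) * (f y + 2 * M) := by
      have a1 := Real.add_one_le_exp (1 * d x y)
      have a2 := (abs_le.1 (hfl x y)).2
      have a3 := hlow y
      have a4 := h.d_nonneg x y
      nlinarith
    calc (f x + 2 * M) * φ x
        ≤ (Real.exp (1 * d x y) * (f y + 2 * M)) * (Real.exp (A * d x y) * φ y) :=
          mul_le_mul h1 (hφ.2 x y) (hφ.1 x).le
            (mul_pos (Real.exp_pos _) (hM.trans_le (hlow y))).le
      _ = _ := by ring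
  have hI : ∫ x, ψ x ∂m = ∫ x, f x * φ x ∂m + 2 * M := by
    simp only [hψ, Pi.add_apply, Pi.mul_apply, Pi.smul_apply, smul_eq_mul]
    rw [integral_add hfint (hφint.const_mul _), integral_const_mul, iφ, mul_one]
  have hIb : |∫ x, f x * φ x ∂m| ≤ M := by
    rw [← Real.norm_eq_abs]
    refine (norm_integral_le_of_norm_le (hφint.const_mul M) (ae_of_all _ fun x => ?_)).trans_eq ?_
    · rw [norm_mul, Real.norm_of_nonneg (hφ.1 x).le]
      exact mul_le_mul_of_nonneg_right (hf x) (hφ.1 x).le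
    · rw [integral_const_mul, iφ, mul_one]
  set I := ∫ x, ψ x ∂m with hIdef
  have hIpos : 0 < I := by linarith [(abs_le.1 hIb).1]
  have hI3 : I ≤ 3 * M := by linarith [(abs_le.1 hIb).2]
  have hψ1 : LogLip d (A + 1) (I⁻¹ • ψ) := by
    refine ⟨fun x => mul_pos (inv_pos.2 hIpos) (hψL.1 x), fun x y => ?_⟩
    have := mul_le_mul_of_nonneg_left (hψL.2 x y) (inv_pos.2 hIpos).le
    simp only [Pi.smul_apply, smul_eq_mul]
    linarith
  have key := hc _ _ hψ1 (hφ.mono h.d_nonneg (by linarith : A ≤ A + 1))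
    (by simp only [Pi.smul_apply, smul_eq_mul]
        rw [integral_const_mul, ← hIdef, inv_mul_cancel₀ hIpos.ne']) iφ n x
  rw [transferOp_iterate_smul, hn, hψ, h.iterate_add hb (N := 2 * M * N), transferOp_iterate_smul,
    hn] at key
  · simp only [Pi.add_apply, Pi.smul_apply, smul_eq_mul] at key
    have e : (transferOp S u)^[n] (f * φ) x - (∫ y, f y * φ y ∂m) * φ x =
        I * (I⁻¹ * ((transferOp S u)^[n] (f * φ) x + 2 * M * φ x) - φ x) := by
      rw [mul_sub, mul_inv_cancel_left₀ hIpos.ne', hI]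
      ring
    rw [e, abs_mul, abs_of_pos hIpos]
    calc _ ≤ (3 * M) * (C * ρ ^ n) := mul_le_mul hI3 key (abs_nonneg _) (by positivity)
      _ = _ := by ring
  · intro x
    simp only [Pi.smul_apply, smul_eq_mul]
    rw [abs_mul, abs_of_pos (by linarith : 0 < 2 * M)]
    exact mul_le_mul_of_nonneg_left (hN x) (by linarith)

end ContractingSystem

/-! ### Local Lipschitz estimates for holomorphic functions. -/

/-- A holomorphic function with bounded derivative is locally Lipschitz. -/
theorem exists_nhds_norm_sub_le {X : Set ℂ} (hX : IsOpen X) {F : ℂ → ℂ} {c : ℝ}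
    (hF : DifferentiableOn ℂ F X) (hc : ∀ x ∈ X, ‖deriv F x‖ ≤ c) {x : ℂ} (hx : x ∈ X) :
    ∃ U ∈ 𝓝 x, ∀ y ∈ U, ∀ z ∈ U, ‖F y - F z‖ ≤ c * ‖y - z‖ := by
  obtain ⟨ε, hε, hb⟩ := Metric.isOpen_iff.1 hX x hx
  exact ⟨_, Metric.ball_mem_nhds x hε, fun y hy z hz =>
    Convex.norm_image_sub_le_of_norm_deriv_le
      (fun w hw => hF.differentiableAt (hX.mem_nhds (hb hw))) (fun w hw => hc w (hb hw))
      (convex_ball x ε) hz hy⟩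

/-- Near x the quotient F / F x lies in the slit plane. There log‖F‖ is, up to a constant, the real
part of a holomorphic logarithm with derivative F'/F. -/
theorem locLip_log_norm {X : Set ℂ} (hX : IsOpen X) {F : ℂ → ℂ} {c : ℝ}
    (hF : DifferentiableOn ℂ F X) (h0 : ∀ x ∈ X, F x ≠ 0)
    (hc : ∀ x ∈ X, ‖deriv F x‖ / ‖F x‖ ≤ c) : LocLip X c (fun x => Real.log ‖F x‖) := by
  intro x hx
  set V := X ∩ (fun y => F y / F x) ⁻¹' Complex.slitPlane with hV
  have hVo : IsOpen V := (hF.continuousOn.div_const _).isOpen_inter_preimage hX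
    Complex.isOpen_slitPlane
  have hxV : x ∈ V := ⟨hx, by simp [div_self (h0 x hx)]⟩
  have hG : ∀ y ∈ V, HasDerivAt (fun y => Complex.log (F y / F x)) (deriv F y / F y) y := by
    intro y hy
    have h1 := (((hF.differentiableAt (hX.mem_nhds hy.1)).hasDerivAt.div_const (F x)).clog hy.2)
    convert h1 using 1
    have := h0 x hx
    have := h0 y hy.1
    field_simp
  obtain ⟨U, hU, h⟩ := exists_nhds_norm_sub_le hVo
    (fun y hy => (hG y hy).differentiableAt.differentiableWithinAt)
    (fun y hy => by rw [(hG y hy).deriv, norm_div]; exact hc y hy.1) hxV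
  refine ⟨U ∩ V, inter_mem hU (hVo.mem_nhds hxV), fun y hy z hz => ?_⟩
  have e : ∀ y ∈ V, (Complex.log (F y / F x)).re = Real.log ‖F y‖ - Real.log ‖F x‖ :=
    fun y hy => by
      rw [Complex.log_re, norm_div, Real.log_div (norm_ne_zero_iff.2 (h0 y hy.1))
        (norm_ne_zero_iff.2 (h0 x hx))]
  have h1 := (Complex.abs_re_le_norm _).trans (h y hy.1 z hz.1)
  rwa [Complex.sub_re, e y hy.2, e z hz.2, sub_sub_sub_cancel_right] at h1

/-! ### Inverse branches, and the contracting system of a Markov map. -/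

/-- The inverse branch of `T` with values in `Z`. -/
noncomputable def invBranch (T : ℂ → ℂ) (Z : Set ℂ) : ℂ → ℂ := Function.invFunOn T Z

namespace IsComplexMarkovMap

variable {T : ℂ → ℂ} {X Y : Set ℂ} {𝒵 : Set (Set ℂ)} {t : ℝ} {m : Measure ℂ}

theorem cell_subset (hT : IsComplexMarkovMap T X Y 𝒵 t m) {Z : Set ℂ} (hZ : Z ∈ 𝒵) : Z ⊆ Y :=
  hT.sUnion_cell ▸ subset_sUnion_of_mem hZ

theorem invBranch_mem (hT : IsComplexMarkovMap T X Y 𝒵 t m) {Z : Set ℂ} (hZ : Z ∈ 𝒵) {x : ℂ}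
    (hx : x ∈ X) : invBranch T Z x ∈ Z :=
  Function.invFunOn_mem ((hT.bijOn Z hZ).surjOn hx)

theorem apply_invBranch (hT : IsComplexMarkovMap T X Y 𝒵 t m) {Z : Set ℂ} (hZ : Z ∈ 𝒵) {x : ℂ}
    (hx : x ∈ X) : T (invBranch T Z x) = x :=
  Function.invFunOn_eq ((hT.bijOn Z hZ).surjOn hx)

theorem invBranch_apply (hT : IsComplexMarkovMap T X Y 𝒵 t m) {Z : Set ℂ} (hZ : Z ∈ 𝒵) {z : ℂ}
    (hz : z ∈ Z) : invBranch T Z (T z) = z :=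
  (hT.bijOn Z hZ).injOn.leftInvOn_invFunOn hz

theorem deriv_ne_zero (hT : IsComplexMarkovMap T X Y 𝒵 t m) {y : ℂ} (hy : y ∈ Y) :
    deriv T y ≠ 0 := by
  obtain ⟨κ, hκ, h⟩ := hT.expanding
  exact norm_pos_iff.1 (by linarith [h y hy])

/-- As T' ≠ 0, T carries the neighbourhood filter of the preimage exactly onto that of x. Continuity
can thus be tested after composing with T, where the branch becomes the identity. -/
theorem continuousAt_invBranch (hT : IsComplexMarkovMap T X Y 𝒵 t m) {Z : Set ℂ} (hZ : Z ∈ 𝒵)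
    {x : ℂ} (hx : x ∈ X) : ContinuousAt (invBranch T Z) x := by
  have hz := hT.invBranch_mem hZ hx
  have hZn := (hT.isOpen_cell Z hZ).mem_nhds hz
  have hs : HasStrictDerivAt T (deriv T (invBranch T Z x)) (invBranch T Z x) :=
    ((hT.holomorphic Z hZ).analyticAt hZn).hasStrictDerivAt
  have hmap := hs.map_nhds_eq (hT.deriv_ne_zero (hT.cell_subset hZ hz))
  rw [hT.apply_invBranch hZ hx] at hmap
  rw [ContinuousAt, ← hmap, tendsto_map'_iff]
  refine Tendsto.congr' ?_ tendsto_id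
  filter_upwards [hZn] with z hz using (hT.invBranch_apply hZ hz).symm

theorem hasDerivAt_invBranch (hT : IsComplexMarkovMap T X Y 𝒵 t m) {Z : Set ℂ} (hZ : Z ∈ 𝒵)
    {x : ℂ} (hx : x ∈ X) :
    HasDerivAt (invBranch T Z) (deriv T (invBranch T Z x))⁻¹ x := by
  have hz := hT.invBranch_mem hZ hx
  refine HasDerivAt.of_local_left_inverse (hT.continuousAt_invBranch hZ hx)
    ((hT.holomorphic Z hZ).differentiableAt ((hT.isOpen_cell Z hZ).mem_nhds hz)).hasDerivAt
    (hT.deriv_ne_zero (hT.cell_subset hZ hz)) ?_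
  filter_upwards [hT.isOpen_X.mem_nhds hx] with y hy using hT.apply_invBranch hZ hy

/-- By the chain rule the logarithmic derivative of T'∘S_Z is T''/(T')² at S_Z x, the quantity that
the distortion hypothesis bounds. -/
theorem locLip_log_deriv (hT : IsComplexMarkovMap T X Y 𝒵 t m) : ∃ K : ℝ, 0 < K ∧
    ∀ Z ∈ 𝒵, LocLip X K (fun x => Real.log ‖deriv T (invBranch T Z x)‖) := by
  obtain ⟨K, hK⟩ := hT.distortion
  refine ⟨max K 1, by positivity, fun Z hZ => ?_⟩
  have hd : ∀ x ∈ X, HasDerivAt (fun x => deriv T (invBranch T Z x))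
      (deriv (deriv T) (invBranch T Z x) * (deriv T (invBranch T Z x))⁻¹) x := fun x hx => by
    have h1 : HasDerivAt (deriv T) (deriv (deriv T) (invBranch T Z x)) (invBranch T Z x) :=
      (((hT.holomorphic Z hZ).deriv (hT.isOpen_cell Z hZ)).differentiableAt
        ((hT.isOpen_cell Z hZ).mem_nhds (hT.invBranch_mem hZ hx))).hasDerivAt
    exact h1.comp x (hT.hasDerivAt_invBranch hZ hx)
  refine locLip_log_norm hT.isOpen_X
    (fun x hx => (hd x hx).differentiableAt.differentiableWithinAt)
    (fun x hx => hT.deriv_ne_zero (hT.cell_subset hZ (hT.invBranch_mem hZ hx))) fun x hx => ?_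
  have := hK Z hZ _ (hT.invBranch_mem hZ hx)
  rw [(hd x hx).deriv, norm_mul, norm_inv, ← div_eq_mul_inv, div_div, ← sq]
  exact this.trans (le_max_left _ _)

theorem exists_innerDist_le (hT : IsComplexMarkovMap T X Y 𝒵 t m) :
    ∃ K : ℝ≥0, ∀ x ∈ X, ∀ y ∈ X, innerDist X x y ≤ K * ‖x - y‖ₑ := by
  obtain ⟨K, hK⟩ := hT.convexLike
  refine ⟨K, fun x hx y hy => ?_⟩
  obtain rfl | hxy := eq_or_ne x y
  · refine (iInf₂_le (Path.refl x) fun s => hx).trans ?_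
    have : eVariationOn (fun s : unitInterval => (Path.refl x) s) univ = 0 :=
      eVariationOn.constant_on (by
        rintro _ ⟨a, -, rfl⟩ _ ⟨b, -, rfl⟩
        rfl)
    rw [this]
    exact zero_le
  · have hXc : X ∈ cylinders T X 𝒵 0 := ⟨fun i => i.elim0, fun i => i.elim0, by
      ext z
      simp⟩
    have h := hK 0 X hXc x hx y hy hxy
    rwa [ENNReal.div_le_iff (by simpa [sub_eq_zero] using hxy) (by finiteness)] at h

theorem lipDist_invBranch_le (hT : IsComplexMarkovMap T X Y 𝒵 t m) : ∃ r : ℝ, 0 ≤ r ∧ r < 1 ∧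
    ∀ Z ∈ 𝒵, ∀ x ∈ X, ∀ y ∈ X,
      lipDist X (invBranch T Z x) (invBranch T Z y) ≤ r * lipDist X x y := by
  obtain ⟨κ, hκ, h⟩ := hT.expanding
  obtain ⟨K, hK⟩ := hT.exists_innerDist_le
  have hκ0 : 0 < κ := by linarith
  refine ⟨κ⁻¹, by positivity, inv_lt_one_of_one_lt₀ hκ, fun Z hZ x hx y hy => ?_⟩
  refine lipDist_comp_le hK (inv_pos.2 hκ0)
    (fun x hx => hT.subset (hT.cell_subset hZ (hT.invBranch_mem hZ hx)))
    (fun x hx => (hT.continuousAt_invBranch hZ hx).continuousWithinAt) hT.isOpen_X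
    (fun x hx => exists_nhds_norm_sub_le hT.isOpen_X (fun x hx =>
      (hT.hasDerivAt_invBranch hZ hx).differentiableAt.differentiableWithinAt) ?_ hx) hx hy
  intro z hz
  rw [(hT.hasDerivAt_invBranch hZ hz).deriv, norm_inv]
  exact inv_anti₀ hκ0 (h _ (hT.cell_subset hZ (hT.invBranch_mem hZ hz)))

theorem measurable_totalMap (hT : IsComplexMarkovMap T X Y 𝒵 t m) : Measurable (totalMap T Y) := by
  classical
  rw [totalMap, ← piecewise_eq_indicator]
  exact hT.continuousOn.measurable_piecewise continuousOn_const hT.isOpen_Y.measurableSet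

theorem restrict_eq (hT : IsComplexMarkovMap T X Y 𝒵 t m) : m.restrict Y = m := by
  have := hT.isProbabilityMeasure
  exact Measure.restrict_eq_self_of_ae_mem ((prob_compl_eq_zero_iff hT.isOpen_Y.measurableSet).2
    hT.measure_Y)

theorem map_withDensity_cell (hT : IsComplexMarkovMap T X Y 𝒵 t m) {Z : Set ℂ} (hZ : Z ∈ 𝒵) :
    ((m.restrict Z).withDensity fun z => ‖deriv T z‖ₑ ^ t).map (totalMap T Y) = m := by
  have hZm := (hT.isOpen_cell Z hZ).measurableSet
  have hZY := hT.cell_subset hZ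
  ext C hC
  have hC' := hT.measurable_totalMap hC
  rw [Measure.map_apply hT.measurable_totalMap hC, withDensity_apply _ hC',
    Measure.restrict_restrict hC', ← hT.conformal _ (hC'.inter hZm)
      (inter_subset_right.trans hZY) ((hT.bijOn Z hZ).injOn.mono inter_subset_right)]
  have e : T '' (totalMap T Y ⁻¹' C ∩ Z) = C ∩ X := by
    ext x
    constructor
    · rintro ⟨z, ⟨hz, hz'⟩, rfl⟩
      rw [mem_preimage, totalMap, indicator_of_mem (hZY hz')] at hz
      exact ⟨hz, (hT.bijOn Z hZ).mapsTo hz'⟩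
    · rintro ⟨hx, hx'⟩
      refine ⟨_, ⟨?_, hT.invBranch_mem hZ hx'⟩, hT.apply_invBranch hZ hx'⟩
      rw [mem_preimage, totalMap, indicator_of_mem (hZY (hT.invBranch_mem hZ hx')),
        hT.apply_invBranch hZ hx']
      exact hx
  rw [e, ← hT.restrict_eq, Measure.restrict_apply (hC.inter hT.isOpen_X.measurableSet),
    Measure.restrict_apply hC, inter_assoc, inter_eq_self_of_subset_right hT.subset]

/-- Conformality read backwards: m is the image under T of |T'|^t m on Z, and this density cancels
against its inverse. -/
theorem lintegral_invBranch (hT : IsComplexMarkovMap T X Y 𝒵 t m) {Z : Set ℂ} (hZ : Z ∈ 𝒵)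
    {A : Set ℂ} (hA : MeasurableSet A) :
    ∫⁻ x, A.indicator (fun z => (‖deriv T z‖ₑ ^ t)⁻¹) (invBranch T Z x) ∂m = m (A ∩ Z) := by
  have hZm := (hT.isOpen_cell Z hZ).measurableSet
  have hw : Measurable fun z => ‖deriv T z‖ₑ ^ t := (measurable_deriv T).enorm.pow_const t
  have hwi : Measurable fun z => (‖deriv T z‖ₑ ^ t)⁻¹ := hw.inv
  have hk : AEMeasurable (fun x =>
      A.indicator (fun z => (‖deriv T z‖ₑ ^ t)⁻¹) (invBranch T Z x)) m := by
    refine (hwi.indicator hA).comp_aemeasurable ?_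
    rw [← hT.restrict_eq]
    exact ContinuousOn.aemeasurable (fun x hx =>
      (hT.continuousAt_invBranch hZ (hT.subset hx)).continuousWithinAt) hT.isOpen_Y.measurableSet
  have hmap := hT.map_withDensity_cell hZ
  conv_lhs => rw [← hmap]
  rw [lintegral_map' (by rwa [hmap]) hT.measurable_totalMap.aemeasurable]
  have hae : ∀ᵐ z ∂((m.restrict Z).withDensity fun z => ‖deriv T z‖ₑ ^ t),
      A.indicator (fun z => (‖deriv T z‖ₑ ^ t)⁻¹) (invBranch T Z (totalMap T Y z)) =
      A.indicator (fun z => (‖deriv T z‖ₑ ^ t)⁻¹) z := by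
    refine (withDensity_absolutelyContinuous _ _).ae_le ?_
    filter_upwards [ae_restrict_mem hZm] with z hz
    rw [totalMap, indicator_of_mem (hT.cell_subset hZ hz), hT.invBranch_apply hZ hz]
  rw [lintegral_congr_ae hae, lintegral_withDensity_eq_lintegral_mul _ hw (hwi.indicator hA)]
  have h2 : ∀ᵐ z ∂m.restrict Z, ((fun z => ‖deriv T z‖ₑ ^ t) *
      A.indicator (fun z => (‖deriv T z‖ₑ ^ t)⁻¹)) z = A.indicator 1 z := by
    filter_upwards [ae_restrict_mem hZm] with z hz
    have h0 := hT.deriv_ne_zero (hT.cell_subset hZ hz)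
    by_cases hzA : z ∈ A
    · simp only [Pi.mul_apply, indicator_of_mem hzA, Pi.one_apply]
      exact ENNReal.mul_inv_cancel (by simp [h0])
        (ENNReal.rpow_ne_top_of_nonneg hT.t_pos.le (by finiteness))
    · simp [indicator_of_notMem hzA]
  rw [lintegral_congr_ae h2, lintegral_indicator_one hA, Measure.restrict_apply hA]

/-- The inverse branches of `T` as maps of `Y` into itself. -/
noncomputable def branch (hT : IsComplexMarkovMap T X Y 𝒵 t m) (Z : 𝒵) (y : Y) : Y :=
  ⟨invBranch T Z y, hT.cell_subset Z.2 (hT.invBranch_mem Z.2 (hT.subset y.2))⟩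

theorem measurable_branch (hT : IsComplexMarkovMap T X Y 𝒵 t m) (Z : 𝒵) :
    Measurable (hT.branch Z) := by
  refine (Continuous.subtype_mk ?_ _).measurable
  exact continuous_iff_continuousAt.2 fun y =>
    (hT.continuousAt_invBranch Z.2 (hT.subset y.2)).comp continuous_subtype_val.continuousAt

theorem lipDist_measurable (hT : IsComplexMarkovMap T X Y 𝒵 t m) {A : ℝ} {φ : Y → ℝ}
    (hφ : LogLip (fun x y : Y => lipDist X x y) A φ) : Measurable φ := by
  obtain ⟨K, hK⟩ := hT.exists_innerDist_le
  -- A may be negative. With |A| the logarithm of φ is Lipschitz, hence φ is continuous.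
  have h1 : LogLip (fun x y : Y => lipDist X x y) |A| φ := hφ.mono (fun x y => lipDist_nonneg _ _) (le_abs_self A)
  have h2 : ∀ x y : Y, Real.log (φ x) ≤ Real.log (φ y) + (|A| * K) * dist x y := fun x y => by
    have h3 := Real.log_le_log (h1.1 x) (h1.2 x y)
    rw [Real.log_mul (Real.exp_pos _).ne' (h1.1 y).ne', Real.log_exp] at h3
    have h4 := mul_le_mul_of_nonneg_left (lipDist_le hK (hT.subset x.2) (hT.subset y.2))
      (abs_nonneg A)
    rw [Subtype.dist_eq, dist_eq_norm]
    linarith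
  have h3 : LipschitzWith (‖A‖₊ * K) fun x => Real.log (φ x) :=
    LipschitzWith.of_le_add_mul _ h2
  have h4 : φ = fun x => Real.exp (Real.log (φ x)) := by
    ext x
    rw [Real.exp_log (h1.1 x)]
  rw [h4]
  exact (Real.continuous_exp.comp h3.continuous).measurable

theorem lintegral_comap (hT : IsComplexMarkovMap T X Y 𝒵 t m) (k : ℂ → ℝ≥0∞) :
    ∫⁻ y : Y, k y ∂(m.comap Subtype.val) = ∫⁻ y, k y ∂m := by
  rw [lintegral_subtype_comap hT.isOpen_Y.measurableSet, hT.restrict_eq]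

theorem map_comap (hT : IsComplexMarkovMap T X Y 𝒵 t m) :
    (m.comap (Subtype.val : Y → ℂ)).map Subtype.val = m := by
  rw [map_comap_subtype_coe hT.isOpen_Y.measurableSet, hT.restrict_eq]

theorem isProbabilityMeasure_comap (hT : IsComplexMarkovMap T X Y 𝒵 t m) :
    IsProbabilityMeasure (m.comap (Subtype.val : Y → ℂ)) := by
  constructor
  rw [Measure.comap_apply _ Subtype.val_injective
    (fun s hs => hT.isOpen_Y.measurableSet.subtype_image hs) _ MeasurableSet.univ, image_univ,
    Subtype.range_coe, hT.measure_Y]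

/-- Each branch contributes the part of m on its own cell; as the cells partition Y, these parts add
up to m. -/
theorem map_branch (hT : IsComplexMarkovMap T X Y 𝒵 t m) (Z : 𝒵) :
    (((m.comap (Subtype.val : Y → ℂ)).withDensity fun y => ENNReal.ofReal
      (‖deriv T (hT.branch Z y)‖ ^ (-t))).map (hT.branch Z)) =
      (m.comap (Subtype.val : Y → ℂ)).restrict (Subtype.val ⁻¹' (Z : Set ℂ)) := by
  ext A hA
  have hYm := hT.isOpen_Y.measurableSet
  have hA' := hYm.subtype_image hA
  have hSA := hT.measurable_branch Z hA
  rw [Measure.map_apply (hT.measurable_branch Z) hA, withDensity_apply _ hSA,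
    Measure.restrict_apply hA, Measure.comap_apply _ Subtype.val_injective
    (fun s hs => hYm.subtype_image hs) _
    (hA.inter (measurable_subtype_coe (hT.isOpen_cell Z Z.2).measurableSet)),
    image_inter_preimage, ← hT.lintegral_invBranch Z.2 hA', ← hT.lintegral_comap,
    ← lintegral_indicator hSA]
  refine lintegral_congr fun y => ?_
  have e : (invBranch T Z y ∈ (Subtype.val '' A : Set ℂ)) ↔ y ∈ hT.branch Z ⁻¹' A :=
    Subtype.val_injective.mem_set_image (a := hT.branch Z y)
  by_cases hy : y ∈ hT.branch Z ⁻¹' A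
  · rw [indicator_of_mem hy, indicator_of_mem (e.2 hy)]
    have h0 : 0 < ‖deriv T (hT.branch Z y)‖ :=
      norm_pos_iff.2 (hT.deriv_ne_zero (hT.branch Z y).2)
    rw [← ENNReal.ofReal_rpow_of_pos h0, ofReal_norm, ENNReal.rpow_neg]
    rfl
  · rw [indicator_of_notMem hy, indicator_of_notMem (fun h => hy (e.1 h))]

theorem exists_contractingSystem (hT : IsComplexMarkovMap T X Y 𝒵 t m)
    (hY : Bornology.IsBounded Y) : ∃ D r B, ContractingSystem (m.comap (Subtype.val : Y → ℂ))
      (fun x y : Y => lipDist X x y) hT.branch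
      (fun Z y => ‖deriv T (hT.branch Z y)‖ ^ (-t)) D r B := by
  obtain ⟨K, hK⟩ := hT.exists_innerDist_le
  obtain ⟨r, hr0, hr1, hr⟩ := hT.lipDist_invBranch_le
  obtain ⟨B, hB, hlog⟩ := hT.locLip_log_deriv
  have hdpos : ∀ y : Y, 0 < ‖deriv T y‖ := fun y => norm_pos_iff.2 (hT.deriv_ne_zero y.2)
  -- Boundedness of Y gives the finite diameter; the factor t is the exponent of the weight
  -- |T'|^(-t).
  refine ⟨K * Metric.diam Y, r, t * B, fun x y => lipDist_nonneg _ _, fun x y => ?_, hr0, hr1,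
    mul_pos hT.t_pos hB, fun Z x y => hr Z Z.2 _ (hT.subset x.2) _ (hT.subset y.2),
    fun Z y => Real.rpow_pos_of_pos (hdpos _) _, fun Z x y => ?_, hT.measurable_branch,
    fun Z => ?_, fun A φ => hT.lipDist_measurable, ?_⟩
  · refine (lipDist_le hK (hT.subset x.2) (hT.subset y.2)).trans ?_
    rw [← dist_eq_norm]
    exact mul_le_mul_of_nonneg_left (Metric.dist_le_diam_of_mem hY x.2 y.2) K.2
  · have h := (abs_le.1 ((hlog Z Z.2).abs_sub_le_lipDist hK hB (hT.subset x.2)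
      (hT.subset y.2))).1
    rw [Real.rpow_def_of_pos (hdpos _), Real.rpow_def_of_pos (hdpos _), ← Real.exp_add]
    refine Real.exp_le_exp.2 ?_
    have := mul_le_mul_of_nonneg_left h hT.t_pos.le
    simp only [branch]
    linarith
  · exact ((measurable_deriv T).comp
      (measurable_subtype_coe.comp (hT.measurable_branch Z))).norm.pow_const _
  · have := hT.countable.to_subtype
    simp only [hT.map_branch]
    rw [← Measure.restrict_iUnion]
    · have : ⋃ Z : 𝒵, (Subtype.val ⁻¹' (Z : Set ℂ) : Set Y) = univ := by
        rw [← preimage_iUnion, ← sUnion_eq_iUnion, hT.sUnion_cell]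
        exact Subtype.coe_preimage_self Y
      rw [this, Measure.restrict_univ]
    · intro Z Z' hne
      exact (hT.pairwiseDisjoint Z.2 Z'.2 fun h => hne (Subtype.ext h)).preimage _
    · exact fun Z => measurable_subtype_coe (hT.isOpen_cell Z Z.2).measurableSet

end IsComplexMarkovMap

/-! ### The invariant measure and the duality with composition by T. -/

theorem measurable_transferOp {α ι : Type*} [MeasurableSpace α] [Countable ι] {S : ι → α → α}
    {u : ι → α → ℝ} (hS : ∀ i, Measurable (S i)) (hu : ∀ i, Measurable (u i)) {w : α → ℝ}
    (hw : Measurable w) : Measurable (transferOp S u w) :=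
  Measurable.tsum fun i => (hu i).mul (hw.comp (hS i))

theorem measurable_transferOp_iterate {α ι : Type*} [MeasurableSpace α] [Countable ι]
    {S : ι → α → α} {u : ι → α → ℝ} (hS : ∀ i, Measurable (S i)) (hu : ∀ i, Measurable (u i))
    {w : α → ℝ} (hw : Measurable w) (n : ℕ) : Measurable ((transferOp S u)^[n] w) := by
  induction n with
  | zero => exact hw
  | succ n ih =>
    rw [Function.iterate_succ_apply']
    exact measurable_transferOp hS hu ih

namespace IsComplexMarkovMap

variable {T : ℂ → ℂ} {X Y : Set ℂ} {𝒵 : Set (Set ℂ)} {t : ℝ} {m : Measure ℂ}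

theorem totalMap_branch (hT : IsComplexMarkovMap T X Y 𝒵 t m) (Z : 𝒵) (y : Y) :
    totalMap T Y (hT.branch Z y) = y := by
  rw [totalMap, indicator_of_mem (hT.branch Z y).2]
  exact hT.apply_invBranch Z.2 (hT.subset y.2)

/-- The measure on `ℂ` with density `φ` with respect to the restriction of `m` to `Y`. -/
noncomputable def densityMeasure (Y : Set ℂ) (m : Measure ℂ) (φ : Y → ℝ) : Measure ℂ :=
  ((m.comap (Subtype.val : Y → ℂ)).withDensity fun y => ENNReal.ofReal (φ y)).map Subtype.val

section

variable {φ : Y → ℝ}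

theorem lintegral_densityMeasure (hφ : Measurable φ) {k : ℂ → ℝ≥0∞} (hk : Measurable k) :
    ∫⁻ x, k x ∂(densityMeasure Y m φ) =
      ∫⁻ y : Y, ENNReal.ofReal (φ y) * k y ∂(m.comap Subtype.val) := by
  rw [densityMeasure, lintegral_map hk measurable_subtype_coe]
  exact lintegral_withDensity_eq_lintegral_mul _ hφ.ennreal_ofReal
    (hk.comp measurable_subtype_coe)

theorem densityMeasure_absolutelyContinuous (hT : IsComplexMarkovMap T X Y 𝒵 t m) :
    densityMeasure Y m φ ≪ m := by
  have := (withDensity_absolutelyContinuous (m.comap (Subtype.val : Y → ℂ))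
    fun y => ENNReal.ofReal (φ y)).map measurable_subtype_coe
  rwa [hT.map_comap] at this

theorem absolutelyContinuous_densityMeasure (hT : IsComplexMarkovMap T X Y 𝒵 t m)
    (hφ : Measurable φ) (hpos : ∀ y, 0 < φ y) : m ≪ densityMeasure Y m φ := by
  have := (withDensity_absolutelyContinuous' (μ := m.comap (Subtype.val : Y → ℂ))
    hφ.ennreal_ofReal.aemeasurable (ae_of_all _ fun y => by
      simpa using hpos y)).map measurable_subtype_coe
  rwa [hT.map_comap] at this

theorem integral_densityMeasure (hY : IsOpen Y) (hφ : Measurable φ) (hpos : ∀ y, 0 < φ y)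
    {E : Type*} [NormedAddCommGroup E] [NormedSpace ℝ E] (g : ℂ → E) :
    ∫ x, g x ∂(densityMeasure Y m φ) = ∫ y : Y, φ y • g y ∂(m.comap Subtype.val) := by
  rw [densityMeasure, (MeasurableEmbedding.subtype_coe hY.measurableSet).integral_map,
    integral_withDensity_eq_integral_toReal_smul hφ.ennreal_ofReal
      (ae_of_all _ fun _ => ENNReal.ofReal_lt_top)]
  simp only [ENNReal.toReal_ofReal (hpos _).le]

theorem integrable_densityMeasure (hY : IsOpen Y) (hφ : Measurable φ) (hpos : ∀ y, 0 < φ y)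
    {E : Type*} [NormedAddCommGroup E] [NormedSpace ℝ E] {g : ℂ → E} :
    Integrable g (densityMeasure Y m φ) ↔
      Integrable (fun y : Y => φ y • g y) (m.comap Subtype.val) := by
  rw [densityMeasure, (MeasurableEmbedding.subtype_coe hY.measurableSet).integrable_map_iff,
    integrable_withDensity_iff_integrable_smul' hφ.ennreal_ofReal
      (ae_of_all _ fun _ => ENNReal.ofReal_lt_top)]
  simp only [ENNReal.toReal_ofReal (hpos _).le, Function.comp_apply]

theorem integrable_comap (hY : IsOpen Y) (hφ : Measurable φ) {c : ℝ} (hc : 0 < c)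
    (hle : ∀ y, c ≤ φ y) {g : ℂ → ℂ} (hg : Integrable g (densityMeasure Y m φ)) :
    Integrable (fun y : Y => g y) (m.comap Subtype.val) := by
  have hpos : ∀ y, 0 < φ y := fun y => hc.trans_le (hle y)
  have h1 := (integrable_densityMeasure hY hφ hpos).1 hg
  have h2 := h1.bdd_smul (φ := fun y => (φ y)⁻¹) c⁻¹ hφ.inv.aestronglyMeasurable
    (ae_of_all _ fun y => by
      rw [norm_inv, Real.norm_of_nonneg (hpos y).le]
      exact inv_anti₀ hc (hle y))
  refine h2.congr (ae_of_all _ fun y => ?_)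
  change (φ y)⁻¹ • φ y • g y = g y
  rw [smul_smul, inv_mul_cancel₀ (hpos y).ne', one_smul]

end

/-- As T∘S_Z = id, the operator sends φ · (1_A∘T) to (Lφ) · 1_A. Invariance of the measure is thus
the equation Lφ = φ. -/
theorem measurePreserving (hT : IsComplexMarkovMap T X Y 𝒵 t m) {D r B : ℝ}
    (hS : ContractingSystem (m.comap (Subtype.val : Y → ℂ))
      (fun x y : Y => lipDist X x y) hT.branch
      (fun Z y => ‖deriv T (hT.branch Z y)‖ ^ (-t)) D r B) {φ : Y → ℝ} (hφ : Measurable φ)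
    (hpos : ∀ y, 0 < φ y) {M : ℝ} (hM : ∀ y, |φ y| ≤ M)
    (hfix : transferOp hT.branch (fun Z y => ‖deriv T (hT.branch Z y)‖ ^ (-t)) φ = φ) :
    MeasurePreserving (totalMap T Y) (densityMeasure Y m φ) (densityMeasure Y m φ) := by
  have := hT.countable.to_subtype
  have := hT.isProbabilityMeasure_comap
  refine ⟨hT.measurable_totalMap, ?_⟩
  ext A hA
  have hA' := hT.measurable_totalMap hA
  have h1 : Measurable (A.indicator (1 : ℂ → ℝ≥0∞)) := measurable_one.indicator hA
  have h2 : Measurable fun x => A.indicator (1 : ℂ → ℝ≥0∞) (totalMap T Y x) :=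
    h1.comp hT.measurable_totalMap
  rw [Measure.map_apply hT.measurable_totalMap hA, ← lintegral_indicator_one hA,
    ← lintegral_indicator_one hA', lintegral_densityMeasure hφ h1]
  refine (lintegral_densityMeasure hφ h2).trans ?_
  refine (hS.lintegral_eq (hφ.ennreal_ofReal.mul (h2.comp measurable_subtype_coe))).trans ?_
  refine lintegral_congr fun y => ?_
  simp only [Pi.mul_apply, Function.comp_apply, hT.totalMap_branch, ← mul_assoc, ENNReal.tsum_mul_right]
  congr 1
  conv_rhs => rw [← hfix]
  rw [transferOp, ENNReal.ofReal_tsum_of_nonneg _ (hS.summable_transfer hM y)]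
  · simp only [ENNReal.ofReal_mul (hS.u_pos _ _).le]
  · exact fun Z => (mul_pos (hS.u_pos _ _) (hpos _)).le

/-- Integrability is required for every n because m is not assumed invariant; it will come from the
invariant measure, whose density is bounded below. -/
theorem integral_comp_iterate (hT : IsComplexMarkovMap T X Y 𝒵 t m) {D r B : ℝ}
    (hS : ContractingSystem (m.comap (Subtype.val : Y → ℂ))
      (fun x y : Y => lipDist X x y) hT.branch
      (fun Z y => ‖deriv T (hT.branch Z y)‖ ^ (-t)) D r B) {g : ℂ → ℂ}
    (hg : ∀ n : ℕ, Integrable (fun y : Y => g ((totalMap T Y)^[n] y)) (m.comap Subtype.val))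
    (n : ℕ) {w : Y → ℝ} (hw : Measurable w) {M : ℝ} (hM : ∀ y, |w y| ≤ M) :
    ∫ y : Y, w y • g ((totalMap T Y)^[n] y) ∂(m.comap Subtype.val) =
      ∫ y : Y, (transferOp hT.branch (fun Z y => ‖deriv T (hT.branch Z y)‖ ^ (-t)))^[n] w y • g y
        ∂(m.comap Subtype.val) := by
  have := hT.countable.to_subtype
  have := hT.isProbabilityMeasure_comap
  induction n generalizing w M with
  | zero => rfl
  | succ n ih =>
    obtain ⟨Q, -, hQ⟩ := hS.exists_bound_transferOp
    rw [Function.iterate_succ_apply (f := transferOp _ _),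
      ← ih (measurable_transferOp hS.measurable_S hS.measurable_u hw) (hQ w M hM)]
    refine (hS.integral_eq ((hg (n + 1)).bdd_smul M hw.aestronglyMeasurable
      (ae_of_all _ hM))).trans ?_
    refine integral_congr_ae (ae_of_all _ fun y => ?_)
    simp only [Pi.smul_apply', Function.iterate_succ_apply, hT.totalMap_branch, smul_smul]
    exact (hS.summable_transfer hM y).tsum_smul_const _

end IsComplexMarkovMap

/-! ### From decay of correlations to mixing and ergodicity. -/

theorem lipNorm_ne_top {X : Set ℂ} {f : ℂ → ℂ} {K : ℝ≥0} (hf : LipschitzWith K f) {M : ℝ≥0}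
    (hM : ∀ x, ‖f x‖ ≤ M) : lipNorm X f ≠ ⊤ := by
  have h1 : (⨆ x ∈ X, ‖f x‖ₑ) ≤ M := iSup₂_le fun x _ => enorm_le_coe.2 (hM x)
  have h2 : (⨆ x ∈ X, ⨆ y ∈ X, ⨆ _ : x ≠ y, ‖f x - f y‖ₑ / ‖x - y‖ₑ) ≤ K := by
    refine iSup₂_le fun x _ => iSup₂_le fun y _ => iSup_le fun hxy => ?_
    refine ENNReal.div_le_of_le_mul ?_
    simpa [edist_eq_enorm_sub] using hf x y
  exact ne_top_of_le_ne_top (by finiteness) (add_le_add h1 h2)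

/-- Smooth compactly supported functions are dense in L¹, and they are bounded and Lipschitz. -/
theorem exists_lipschitz_approx {μ : Measure ℂ} [IsProbabilityMeasure μ] {A : Set ℂ}
    (hA : MeasurableSet A) {ε : ℝ} (hε : 0 < ε) : ∃ (f : ℂ → ℂ) (K M : ℝ≥0), LipschitzWith K f ∧
      (∀ x, ‖f x‖ ≤ M) ∧ ∫ x, ‖A.indicator 1 x - f x‖ ∂μ ≤ ε := by
  have hmem : MemLp (A.indicator (1 : ℂ → ℂ)) 1 μ := (memLp_const (1 : ℂ)).indicator hA
  obtain ⟨f, hf1, hf2, hf3⟩ := hmem.exist_eLpNorm_sub_le ENNReal.one_ne_top le_rfl hε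
  obtain ⟨K, hK⟩ := hf2.lipschitzWith_of_hasCompactSupport hf1 (by simp)
  obtain ⟨M, hM⟩ := hf1.exists_bound_of_continuous hf2.continuous
  refine ⟨f, K, M.toNNReal, hK, fun x => (hM x).trans (Real.le_coe_toNNReal M), ?_⟩
  rw [eLpNorm_one_eq_lintegral_enorm] at hf3
  have hint : Integrable (A.indicator (1 : ℂ → ℂ) - f) μ :=
    (hmem.integrable le_rfl).sub (hf2.continuous.integrable_of_hasCompactSupport hf1)
  rw [← ofReal_integral_norm_eq_lintegral_enorm hint, ENNReal.ofReal_le_ofReal_iff hε.le] at hf3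
  exact hf3

theorem integral_indicator_one_complex {μ : Measure ℂ} {A : Set ℂ} (hA : MeasurableSet A) :
    ∫ x, A.indicator (1 : ℂ → ℂ) x ∂μ = μ.real A := by
  rw [integral_indicator hA]
  simp

/-- Decay of correlations against Lipschitz functions implies mixing. -/
theorem isMixing_of_decay {μ : Measure ℂ} [IsProbabilityMeasure μ] {F : ℂ → ℂ}
    (hF : MeasurePreserving F μ μ)
    (h : ∀ (f : ℂ → ℂ) (K M : ℝ≥0), LipschitzWith K f → (∀ x, ‖f x‖ ≤ M) → ∀ g : ℂ → ℂ,
      Integrable g μ → Tendsto (fun n : ℕ => (∫ x, f x * g (F^[n] x) ∂μ) -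
        (∫ x, f x ∂μ) * ∫ x, g x ∂μ) atTop (𝓝 0)) : IsMixing F μ := by
  intro A B hA hB
  have key : Tendsto (fun n : ℕ => μ.real (A ∩ F^[n] ⁻¹' B)) atTop (𝓝 (μ.real A * μ.real B)) := by
    rw [Metric.tendsto_atTop]
    intro ε hε
    -- Only the indicator of A is approximated; that of B serves directly as the integrable
    -- observable. Being bounded by 1, it lets each replacement of 1_A by f cost at most ε/4.
    obtain ⟨f, K, M, hK, hM, hf⟩ := exists_lipschitz_approx (μ := μ) hA
      (by positivity : 0 < ε / 4)
    set g : ℂ → ℂ := B.indicator 1 with hg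
    have hgint : Integrable g μ := (integrable_const (1 : ℂ)).indicator hB
    have hfint : Integrable f μ := Integrable.of_bound hK.continuous.aestronglyMeasurable M
      (ae_of_all _ hM)
    have hAint : Integrable (A.indicator (1 : ℂ → ℂ)) μ := (integrable_const (1 : ℂ)).indicator hA
    have hdint : Integrable (fun x => A.indicator (1 : ℂ → ℂ) x - f x) μ := hAint.sub hfint
    have hg1 : ∀ x, ‖g x‖ ≤ 1 := fun x => by
      by_cases hx : x ∈ B <;> simp [hg, hx]
    obtain ⟨N, hN⟩ := Metric.tendsto_atTop.1 (h f K M hK hM g hgint) (ε / 4) (by positivity)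
    refine ⟨N, fun n hn => ?_⟩
    have hFn := hF.iterate n
    have hgm : AEStronglyMeasurable (fun x => g (F^[n] x)) μ :=
      ((measurable_one.indicator hB).comp hFn.measurable).aestronglyMeasurable
    have e1 : ((μ.real (A ∩ F^[n] ⁻¹' B) : ℝ) : ℂ) =
        ∫ x, A.indicator (1 : ℂ → ℂ) x * g (F^[n] x) ∂μ := by
      have : ∀ x, A.indicator (1 : ℂ → ℂ) x * g (F^[n] x) =
          (A ∩ F^[n] ⁻¹' B).indicator 1 x := fun x => by
        by_cases hx : x ∈ A <;> by_cases hx' : F^[n] x ∈ B <;> simp [hg, hx, hx']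
      simp only [this]
      rw [integral_indicator_one_complex (hA.inter (hFn.measurable hB))]
    have e2 : (μ.real A : ℂ) = ∫ x, A.indicator (1 : ℂ → ℂ) x ∂μ :=
      (integral_indicator_one_complex hA).symm
    have e3 : (μ.real B : ℂ) = ∫ x, g x ∂μ := (integral_indicator_one_complex hB).symm
    have i1 : Integrable (fun x => A.indicator (1 : ℂ → ℂ) x * g (F^[n] x)) μ :=
      hAint.mul_bdd (c := 1) hgm (ae_of_all _ fun x => hg1 _)
    have i2 : Integrable (fun x => f x * g (F^[n] x)) μ :=
      hfint.mul_bdd (c := 1) hgm (ae_of_all _ fun x => hg1 _)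
    have b1 : ‖(∫ x, A.indicator (1 : ℂ → ℂ) x * g (F^[n] x) ∂μ) -
        ∫ x, f x * g (F^[n] x) ∂μ‖ ≤ ε / 4 := by
      rw [← integral_sub i1 i2]
      refine (norm_integral_le_of_norm_le hdint.norm (ae_of_all _ fun x => ?_)).trans hf
      rw [← sub_mul, norm_mul]
      exact mul_le_of_le_one_right (norm_nonneg _) (hg1 _)
    have b2 : ‖(∫ x, f x ∂μ) - ∫ x, A.indicator (1 : ℂ → ℂ) x ∂μ‖ ≤ ε / 4 := by
      rw [norm_sub_rev, ← integral_sub hAint hfint]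
      exact (norm_integral_le_integral_norm _).trans hf
    have b3 : ‖((∫ x, f x ∂μ) - ∫ x, A.indicator (1 : ℂ → ℂ) x ∂μ) * ∫ x, g x ∂μ‖ ≤ ε / 4 := by
      rw [norm_mul]
      refine (mul_le_of_le_one_right (norm_nonneg _) ?_).trans b2
      rw [← e3, Complex.norm_real, Real.norm_of_nonneg measureReal_nonneg]
      exact measureReal_le_one
    have b4 := hN n hn
    rw [dist_zero_right] at b4
    rw [dist_eq_norm, ← Complex.norm_real]
    push_cast
    rw [e1, e2, e3]
    calc _ = ‖((∫ x, A.indicator (1 : ℂ → ℂ) x * g (F^[n] x) ∂μ) - ∫ x, f x * g (F^[n] x) ∂μ) +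
          ((∫ x, f x * g (F^[n] x) ∂μ) - (∫ x, f x ∂μ) * ∫ x, g x ∂μ) +
          ((∫ x, f x ∂μ) - ∫ x, A.indicator (1 : ℂ → ℂ) x ∂μ) * ∫ x, g x ∂μ‖ := by
            congr 1
            ring
      _ ≤ ε / 4 + ‖(∫ x, f x * g (F^[n] x) ∂μ) - (∫ x, f x ∂μ) * ∫ x, g x ∂μ‖ + ε / 4 :=
        (norm_add₃_le).trans (add_le_add_three b1 le_rfl b3)
      _ < ε := by linarith
  have h2 := ENNReal.tendsto_ofReal key
  rw [ENNReal.ofReal_mul measureReal_nonneg] at h2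
  simpa using h2

/-- For an invariant set s mixing gives μ s = (μ s)², so μ s is 0 or 1. -/
theorem ergodic_of_isMixing {μ : Measure ℂ} [IsProbabilityMeasure μ] {F : ℂ → ℂ}
    (hF : MeasurePreserving F μ μ) (h : IsMixing F μ) : Ergodic F μ := by
  refine ⟨hF, ⟨fun {s} hs hinv => ?_⟩⟩
  have hn : ∀ n : ℕ, F^[n] ⁻¹' s = s := fun n => by
    rw [preimage_iterate_eq]
    exact Function.iterate_fixed hinv n
  have h1 := h s s hs hs
  simp only [hn, inter_self] at h1
  have h2 : μ s = μ s * μ s := tendsto_nhds_unique tendsto_const_nhds h1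
  rw [Filter.eventuallyConst_set']
  by_cases h0 : μ s = 0
  · exact Or.inl (ae_eq_empty.2 h0)
  · refine Or.inr (eventuallyEq_univ.2 ((prob_compl_eq_zero_iff hs).2 ?_))
    have h3 : μ s * 1 = μ s * μ s := by rw [mul_one]; exact h2
    exact ((ENNReal.mul_right_inj h0 (measure_ne_top _ _)).1 h3).symm

/-! ### Exponential decay for complex observables, and the theorem. -/

theorem norm_le_lipNorm {X : Set ℂ} {f : ℂ → ℂ} (hf : lipNorm X f ≠ ⊤) {x : ℂ} (hx : x ∈ X) :
    ‖f x‖ ≤ (lipNorm X f).toReal := by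
  have h : ‖f x‖ₑ ≤ lipNorm X f :=
    (le_iSup₂ (f := fun x (_ : x ∈ X) => ‖f x‖ₑ) x hx).trans le_self_add
  simpa using ENNReal.toReal_mono hf h

theorem norm_sub_le_lipNorm {X : Set ℂ} {f : ℂ → ℂ} (hf : lipNorm X f ≠ ⊤) {x y : ℂ}
    (hx : x ∈ X) (hy : y ∈ X) : ‖f x - f y‖ ≤ (lipNorm X f).toReal * ‖x - y‖ := by
  obtain rfl | hxy := eq_or_ne x y
  · simp
  have h : ‖f x - f y‖ₑ / ‖x - y‖ₑ ≤ lipNorm X f := by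
    refine le_trans ?_ le_add_self
    exact (le_iSup (fun _ : x ≠ y => ‖f x - f y‖ₑ / ‖x - y‖ₑ) hxy).trans
      ((le_iSup₂ (f := fun y (_ : y ∈ X) => ⨆ _ : x ≠ y, ‖f x - f y‖ₑ / ‖x - y‖ₑ) y hy).trans
        (le_iSup₂ (f := fun x (_ : x ∈ X) => ⨆ y ∈ X, ⨆ _ : x ≠ y, ‖f x - f y‖ₑ / ‖x - y‖ₑ) x hx))
  rw [ENNReal.div_le_iff (by simpa [sub_eq_zero] using hxy) (by finiteness)] at h
  simpa using ENNReal.toReal_mono (by finiteness) h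

namespace IsComplexMarkovMap

variable {T : ℂ → ℂ} {X Y : Set ℂ} {𝒵 : Set (Set ℂ)} {t : ℝ} {m : Measure ℂ}

/-- Duality moves all iterates onto fφ, where the estimate δ is uniform. It can therefore be
integrated against any g in L¹. -/
theorem norm_integral_sub_le (hT : IsComplexMarkovMap T X Y 𝒵 t m) {D r B : ℝ}
    (hS : ContractingSystem (m.comap (Subtype.val : Y → ℂ))
      (fun x y : Y => lipDist X x y) hT.branch
      (fun Z y => ‖deriv T (hT.branch Z y)‖ ^ (-t)) D r B) {φ : Y → ℝ} (hφ : Measurable φ)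
    {N : ℝ} (hN : ∀ y, |φ y| ≤ N) {g : ℂ → ℂ}
    (hg : ∀ n : ℕ, Integrable (fun y : Y => g ((totalMap T Y)^[n] y)) (m.comap Subtype.val))
    {n : ℕ} {f : Y → ℝ} (hf : Measurable f) {M : ℝ} (hM : ∀ y, |f y| ≤ M) {δ : ℝ}
    (hδ : ∀ y, |(transferOp hT.branch (fun Z y => ‖deriv T (hT.branch Z y)‖ ^ (-t)))^[n] (f * φ) y -
      (∫ y, f y * φ y ∂(m.comap Subtype.val)) * φ y| ≤ δ) :
    ‖(∫ y : Y, (f y * φ y) • g ((totalMap T Y)^[n] y) ∂(m.comap Subtype.val)) -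
      (∫ y : Y, f y * φ y ∂(m.comap Subtype.val)) •
        ∫ y : Y, φ y • g y ∂(m.comap Subtype.val)‖ ≤
      δ * ∫ y : Y, ‖g y‖ ∂(m.comap Subtype.val) := by
  have := hT.countable.to_subtype
  have := hT.isProbabilityMeasure_comap
  have hb : ∀ y, |(f * φ) y| ≤ M * N := fun y => by
    rw [Pi.mul_apply, abs_mul]
    exact mul_le_mul (hM y) (hN y) (abs_nonneg _) ((abs_nonneg _).trans (hM y))
  obtain ⟨Q, hQ⟩ := hS.exists_bound_iterate hb n
  have h1 := hT.integral_comp_iterate hS hg n (hf.mul hφ) hb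
  simp only [Pi.mul_apply] at h1
  rw [h1, ← integral_smul, ← integral_sub]
  · rw [← integral_const_mul]
    refine norm_integral_le_of_norm_le ((hg 0).norm.const_mul δ) (ae_of_all _ fun y => ?_)
    rw [smul_smul, ← sub_smul, norm_smul]
    exact mul_le_mul_of_nonneg_right (hδ y) (norm_nonneg _)
  · exact (hg 0).bdd_smul Q (measurable_transferOp_iterate hS.measurable_S hS.measurable_u
      (hf.mul hφ) n).aestronglyMeasurable (ae_of_all _ hQ)
  · exact ((hg 0).bdd_smul N hφ.aestronglyMeasurable (ae_of_all _ hN)).smul _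

/-- A complex Markov map has an equivalent invariant probability measure with exponential decay
of correlations. -/
theorem exists_invariant_decay (hT : IsComplexMarkovMap T X Y 𝒵 t m)
    (hY : Bornology.IsBounded Y) :
    ∃ μ : Measure ℂ, IsProbabilityMeasure μ ∧ μ ≪ m ∧ m ≪ μ ∧
      MeasurePreserving (totalMap T Y) μ μ ∧ ∃ C ρ : ℝ, 0 < C ∧ 0 < ρ ∧ ρ < 1 ∧
        ∀ f g : ℂ → ℂ, lipNorm X f ≠ ⊤ → Integrable g μ → ∀ n : ℕ,
          Integrable (fun x => f x * g ((totalMap T Y)^[n] x)) μ ∧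
          ‖(∫ x, f x * g ((totalMap T Y)^[n] x) ∂μ) - (∫ x, f x ∂μ) * ∫ x, g x ∂μ‖ ≤
            C * (lipNorm X f).toReal * (∫ x, ‖g x‖ ∂μ) * ρ ^ n := by
  have := hT.countable.to_subtype
  have := hT.isProbabilityMeasure_comap
  have hYo := hT.isOpen_Y
  obtain ⟨K, hK⟩ := hT.exists_innerDist_le
  obtain ⟨D, r, B, hS⟩ := hT.exists_contractingSystem hY
  obtain ⟨φ, A, hA, hφL, iφ, hfix, C, ρ, hC, hρ0, hρ1, hdecay⟩ := hS.exists_density_decay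
  have hφ : Measurable φ := hT.lipDist_measurable hφL
  have hpos := hφL.1
  set c := Real.exp (-(A * D)) with hcdef
  have hc : 0 < c := Real.exp_pos _
  have hlow : ∀ y, c ≤ φ y := hS.exp_neg_le hA hφL iφ
  obtain ⟨N, hN⟩ := hS.exists_bound hA hφL
  have hφint := hS.integrable_of_logLip hA hφL
  have hmp := hT.measurePreserving hS hφ hpos hN hfix
  -- The factor 2 accounts for real and imaginary parts, and c⁻¹ for bounding the L¹(m) norm of g by
  -- its L¹(μ) norm through φ ≥ c.
  refine ⟨densityMeasure Y m φ, ⟨?_⟩, hT.densityMeasure_absolutelyContinuous,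
    hT.absolutelyContinuous_densityMeasure hφ hpos, hmp, 2 * C * c⁻¹, ρ, by positivity, hρ0, hρ1,
    fun f g hf hg n => ?_⟩
  · rw [← lintegral_one, lintegral_densityMeasure hφ measurable_const]
    simp only [mul_one]
    rw [← ofReal_integral_eq_lintegral_ofReal hφint (ae_of_all _ fun y => (hpos y).le), iφ,
      ENNReal.ofReal_one]
  set M := (lipNorm X f).toReal with hMdef
  have hM0 : 0 ≤ M := ENNReal.toReal_nonneg
  have hgn : ∀ n : ℕ, Integrable (fun y : Y => g ((totalMap T Y)^[n] y)) (m.comap Subtype.val) :=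
    fun n => integrable_comap hYo hφ hc hlow ((hmp.iterate n).integrable_comp_of_integrable hg)
  have hfM : ∀ y : Y, ‖f y‖ ≤ M := fun y => norm_le_lipNorm hf (hT.subset y.2)
  have hfd : ∀ x y : Y, ‖f x - f y‖ ≤ M * ‖(x : ℂ) - y‖ := fun x y =>
    norm_sub_le_lipNorm hf (hT.subset x.2) (hT.subset y.2)
  have hfl : ∀ x y : Y, ‖f x - f y‖ ≤ M * lipDist X x y := fun x y => (hfd x y).trans
    (mul_le_mul_of_nonneg_left (norm_sub_le_lipDist hK (hT.subset x.2) (hT.subset y.2)) hM0)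
  have hfc : Continuous fun y : Y => f y :=
    (LipschitzWith.of_dist_le_mul (K := (lipNorm X f).toNNReal) fun x y => by
      rw [dist_eq_norm, Subtype.dist_eq, dist_eq_norm]
      exact hfd x y).continuous
  have hre := Complex.measurable_re.comp hfc.measurable
  have him := Complex.measurable_im.comp hfc.measurable
  have hreM : ∀ y : Y, |(f y).re| ≤ M := fun y => (Complex.abs_re_le_norm _).trans (hfM y)
  have himM : ∀ y : Y, |(f y).im| ≤ M := fun y => (Complex.abs_im_le_norm _).trans (hfM y)
  have hbdd : ∀ {w : Y → ℝ}, Measurable w → (∀ y, |w y| ≤ M) →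
      Integrable (fun y => w y * φ y) (m.comap Subtype.val) ∧
      Integrable (fun y => (w y * φ y) • g ((totalMap T Y)^[n] y)) (m.comap Subtype.val) :=
    fun {w} hw hwM => by
      have hb : ∀ y, ‖w y * φ y‖ ≤ M * N := fun y => by
        rw [norm_mul]
        exact mul_le_mul (hwM y) (hN y) (abs_nonneg _) hM0
      exact ⟨Integrable.of_bound (hw.mul hφ).aestronglyMeasurable _ (ae_of_all _ hb),
        (hgn n).bdd_smul (M * N) (hw.mul hφ).aestronglyMeasurable (ae_of_all _ hb)⟩
  obtain ⟨r1, r2⟩ := hbdd hre hreM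
  obtain ⟨i1, i2⟩ := hbdd him himM
  simp only [Function.comp_apply] at r1 r2 i1 i2
  -- The operator acts on real functions, so f is split into real and imaginary parts, while g stays
  -- complex.
  have e1 : ∀ y : Y, φ y • (f y * g ((totalMap T Y)^[n] y)) =
      ((f y).re * φ y) • g ((totalMap T Y)^[n] y) +
        Complex.I * ((f y).im * φ y) • g ((totalMap T Y)^[n] y) := fun y => by
    conv_lhs => rw [← Complex.re_add_im (f y)]
    simp only [Complex.real_smul]
    push_cast
    ring
  have e2 : ∀ y : Y, φ y • f y =
      (((f y).re * φ y : ℝ) : ℂ) + Complex.I * (((f y).im * φ y : ℝ) : ℂ) := fun y => by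
    conv_lhs => rw [← Complex.re_add_im (f y)]
    simp only [Complex.real_smul]
    push_cast
    ring
  refine ⟨(integrable_densityMeasure hYo hφ hpos).2 ?_, ?_⟩
  · simp only [e1]
    exact r2.add (i2.const_mul _)
  have hb1 := hT.norm_integral_sub_le hS hφ hN hgn hre hreM
    (hdecay _ M hre hreM (fun x y => by
      have := (Complex.abs_re_le_norm _).trans (hfl x y)
      rwa [Complex.sub_re] at this) n)
  have hb2 := hT.norm_integral_sub_le hS hφ hN hgn him himM
    (hdecay _ M him himM (fun x y => by
      have := (Complex.abs_im_le_norm _).trans (hfl x y)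
      rwa [Complex.sub_im] at this) n)
  simp only [Function.comp_apply] at hb1 hb2
  have hgle : ∫ y : Y, ‖g y‖ ∂(m.comap Subtype.val) ≤
      c⁻¹ * ∫ x, ‖g x‖ ∂(densityMeasure Y m φ) := by
    rw [integral_densityMeasure hYo hφ hpos, ← integral_const_mul]
    refine integral_mono (hgn 0).norm
      (((integrable_densityMeasure hYo hφ hpos).1 hg.norm).const_mul _) fun y => ?_
    simp only [smul_eq_mul]
    rw [← mul_assoc]
    exact le_mul_of_one_le_left (norm_nonneg _)
      (by rw [inv_mul_eq_div, one_le_div hc]; exact hlow y)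
  rw [integral_densityMeasure hYo hφ hpos, integral_densityMeasure hYo hφ hpos f,
    integral_densityMeasure hYo hφ hpos g]
  simp only [e1, e2]
  rw [integral_add r2 (i2.const_mul _), integral_const_mul,
    integral_add r1.ofReal (i1.ofReal.const_mul _), integral_const_mul, integral_complex_ofReal,
    integral_complex_ofReal]
  simp only [Complex.real_smul (x := ∫ y : Y, _ ∂_)] at hb1 hb2
  generalize (∫ y : Y, φ y • g y ∂(m.comap Subtype.val)) = G at hb1 hb2 ⊢
  generalize (∫ y : Y, ((f y).re * φ y) • g ((totalMap T Y)^[n] y) ∂(m.comap Subtype.val)) = P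
    at hb1 ⊢
  generalize (∫ y : Y, ((f y).im * φ y) • g ((totalMap T Y)^[n] y) ∂(m.comap Subtype.val)) = P'
    at hb2 ⊢
  generalize (∫ y : Y, (f y).re * φ y ∂(m.comap Subtype.val)) = a at hb1 ⊢
  generalize (∫ y : Y, (f y).im * φ y ∂(m.comap Subtype.val)) = b at hb2 ⊢
  have e3 : P + Complex.I * P' - ((a : ℂ) + Complex.I * b) * G =
      (P - a * G) + Complex.I * (P' - b * G) := by ring
  rw [e3]
  have hδ : 0 ≤ C * M * ρ ^ n := by positivity
  calc _ ≤ ‖P - a * G‖ + ‖P' - b * G‖ := by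
        refine (norm_add_le _ _).trans_eq ?_
        rw [norm_mul, Complex.norm_I, one_mul]
    _ ≤ 2 * (C * M * ρ ^ n * ∫ y : Y, ‖g y‖ ∂(m.comap Subtype.val)) := by linarith
    _ ≤ 2 * (C * M * ρ ^ n * (c⁻¹ * ∫ x, ‖g x‖ ∂(densityMeasure Y m φ))) := by gcongr
    _ = _ := by ring

end IsComplexMarkovMap

theorem mainTheorem7 (T : ℂ → ℂ) (X Y : Set ℂ) (𝒵 : Set (Set ℂ)) (t : ℝ) (m : Measure ℂ)
    (hT : IsComplexMarkovMap T X Y 𝒵 t m) (hY : Bornology.IsBounded Y) :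
    ∃ μ : Measure ℂ, IsProbabilityMeasure μ ∧ μ ≪ m ∧ m ≪ μ ∧
      Ergodic (totalMap T Y) μ ∧ IsMixing (totalMap T Y) μ ∧
      ∃ C ρ : ℝ, 0 < C ∧ 0 < ρ ∧ ρ < 1 ∧
        ∀ f g : ℂ → ℂ, lipNorm X f ≠ ⊤ → Integrable g μ → ∀ n : ℕ,
          Integrable (fun x => f x * g ((totalMap T Y)^[n] x)) μ ∧
          ‖(∫ x, f x * g ((totalMap T Y)^[n] x) ∂μ) - (∫ x, f x ∂μ) * ∫ x, g x ∂μ‖ ≤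
            C * (lipNorm X f).toReal * (∫ x, ‖g x‖ ∂μ) * ρ ^ n := by
  obtain ⟨μ, hμ, h1, h2, hmp, C, ρ, hC, hρ0, hρ1, hdecay⟩ := hT.exists_invariant_decay hY
  have hmix : IsMixing (totalMap T Y) μ := by
    refine isMixing_of_decay hmp fun f K M hK hM g hg => ?_
    rw [tendsto_zero_iff_norm_tendsto_zero]
    refine squeeze_zero (fun _ => norm_nonneg _)
      (fun n => (hdecay f g (lipNorm_ne_top hK hM) hg n).2) ?_
    simpa using (tendsto_pow_atTop_nhds_zero_of_lt_one hρ0.le hρ1).const_mul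
      (C * (lipNorm X f).toReal * ∫ x, ‖g x‖ ∂μ)
  exact ⟨μ, hμ, h1, h2, ergodic_of_isMixing hmp hmix, hmix, C, ρ, hC, hρ0, hρ1, hdecay⟩
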